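/- Let $\Sigma$ be a compact connected oriented smooth surface of genus $0$ with non-empty boundary, that is, a smooth surface diffeomorphic to a closed disc from which finitely many (possibly zero) open discs, with disjoint closures contained in the interior of the closed disc, have been removed. Number its boundary components $\partial\Sigma=\coprod_{j=0}^{n}\partial_j\Sigma$, each with the orientation induced by $\Sigma$. A framing of $\Sigma$ is an orientation-preserving global trivialization $T\Sigma\cong\Sigma\times\mathbb R^2$, regarded through its second component as a map $f\colon T\Sigma\to\mathbb R^2$; two framings are homotopic if they are joined by a homotopy through framings, and $F(\Sigma)$ is the set of homotopy classes of framings. For a smooth immersion $\ell\colon S^1\to\Sigma$, the rotation number $\mathrm{rot}_f(\ell)\in\mathbb Z$ is the degree of $S^1\to S^1$, $t\mapsto f(\dot\ell(t))/\Vert f(\dot\ell(t))\Vert$, and $\mathrm{rot}_f(\partial_j\Sigma)$ is the rotation number of an orientation-compatible simple closed smooth regular parametrization of $\partial_j\Sigma$. Then: (1) Two framings $f_1,f_2$ of $\Sigma$ are homotopic if and only if $\mathrm{rot}_{f_1}(\partial_j\Sigma)=\mathrm{rot}_{f_2}(\partial_j\Sigma)$ for all $0\le j\le n$. (2) The mapping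 class group of $\Sigma$ (isotopy classes of orientation-preserving diffeomorphisms fixing $\partial\Sigma$ pointwise) acts trivially on $F(\Sigma)$: for every such diffeomorphism $\varphi$ and every framing $f$, the framing $f\circ d\varphi$ is homotopic to $f$. Hence $F(\Sigma)/\mathcal M(\Sigma)=F(\Sigma)$. (3) The map $f\mapsto(\mathrm{rot}_f(\partial_j\Sigma)+1)_{j=0}^{n}$ is a well-defined bijection $$F(\Sigma)\;\cong\;\Bigl\{(\nu_j)_{j=0}^n\in\mathbb Z^{n+1}\;:\;\sum_{j=0}^n\nu_j=2\Bigr\}.$$ -/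

import Mathlib

open scoped Manifold ContDiff Topology

/-- The oriented Euclidean plane `ℝ²`. -/
abbrev Plane : Type := EuclideanSpace ℝ (Fin 2)

/-- The standard orientation of `ℝ²`. -/
noncomputable def stdOrientation : Orientation ℝ Plane (Fin 2) :=
  (EuclideanSpace.basisFun (Fin 2) ℝ).toBasis.orientation

/-- An orientation of a smooth surface with boundary: a choice of an orientation of each tangent
plane that is locally constant in the local trivializations of the tangent bundle. -/
structure SurfaceOrientation (M : Type*) [TopologicalSpace M]
    [ChartedSpace (EuclideanHalfSpace 2) M] [IsManifold (𝓡∂ 2) ∞ M] where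
  orient : ∀ x : M, Orientation ℝ (TangentSpace (𝓡∂ 2) x) (Fin 2)
  locallyConstant : ∀ x₀ : M, ∃ ε : Orientation ℝ Plane (Fin 2), ∀ᶠ x in 𝓝 x₀,
    ∃ hx : x ∈ (trivializationAt Plane (TangentSpace (𝓡∂ 2) : M → Type _) x₀).baseSet,
      Orientation.map (Fin 2)
        ((trivializationAt Plane (TangentSpace (𝓡∂ 2) : M → Type _) x₀).linearEquivAt ℝ x hx)
        (orient x) = ε

/-- `(v, w)` is a positively oriented basis of the oriented plane `(V, ε)`. -/
def IsPositiveBasis {V : Type*} [AddCommGroup V] [Module ℝ V] (ε : Orientation ℝ V (Fin 2))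
    (v w : V) : Prop :=
  ∃ b : Module.Basis (Fin 2) ℝ V, b 0 = v ∧ b 1 = w ∧ b.orientation = ε

/-- Transport of orientations is functorial. -/
theorem orientation_map_trans {U V W : Type*} [AddCommGroup U] [Module ℝ U] [AddCommGroup V]
    [Module ℝ V] [AddCommGroup W] [Module ℝ W] (d : U ≃ₗ[ℝ] V) (e : V ≃ₗ[ℝ] W)
    (ε : Orientation ℝ U (Fin 2)) :
    Orientation.map (Fin 2) (d.trans e) ε = Orientation.map (Fin 2) e (Orientation.map (Fin 2) d ε) := by
  induction ε using Module.Ray.ind with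
  | h v hv => rfl

/-! ### Genus zero -/

/-- The compact plane domain obtained from the closed unit disc by removing the open discs with
centres `c i` and radii `r i`. -/
def discWithHoles {m : ℕ} (c : Fin m → Plane) (r : Fin m → ℝ) : Set Plane :=
  Metric.closedBall 0 1 \ ⋃ i, Metric.ball (c i) (r i)

/-- A compact surface with non-empty boundary has genus `0` if it is diffeomorphic to a closed disc
from which finitely many open discs, with disjoint closures in the interior of the disc, are removed
(equivalently, to a sphere with finitely many, and at least one, such discs removed). As the surface
is compact, a diffeomorphism onto such a domain is an injective immersion between manifolds of the
same dimension whose image is the domain. -/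
def IsGenusZero (M : Type*) [TopologicalSpace M]
    [ChartedSpace (EuclideanHalfSpace 2) M] [IsManifold (𝓡∂ 2) ∞ M] : Prop :=
  ∃ (m : ℕ) (c : Fin m → Plane) (r : Fin m → ℝ),
    (∀ i, 0 < r i) ∧
    (∀ i, Metric.closedBall (c i) (r i) ⊆ Metric.ball 0 1) ∧
    (∀ i j, i ≠ j → Disjoint (Metric.closedBall (c i) (r i)) (Metric.closedBall (c j) (r j))) ∧
    ∃ φ : M → Plane, ContMDiff (𝓡∂ 2) 𝓘(ℝ, Plane) ∞ φ ∧ Function.Injective φ ∧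
      (∀ x, Function.Bijective (mfderiv (𝓡∂ 2) 𝓘(ℝ, Plane) φ x)) ∧
      Set.range φ = discWithHoles c r

/-! ### Framings and their homotopy classes -/

/-- A continuous map `TM → ℝ²` is a framing if it restricts to an orientation-preserving linear
isomorphism on each tangent plane. -/
def IsFraming {M : Type*} [TopologicalSpace M] [ChartedSpace (EuclideanHalfSpace 2) M]
    [IsManifold (𝓡∂ 2) ∞ M] (o : SurfaceOrientation M)
    (f : C(TangentBundle (𝓡∂ 2) M, Plane)) : Prop :=
  ∀ x : M, ∃ e : TangentSpace (𝓡∂ 2) x ≃ₗ[ℝ] Plane,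
    (∀ v : TangentSpace (𝓡∂ 2) x, f ⟨x, v⟩ = e v) ∧
    Orientation.map (Fin 2) e (o.orient x) = stdOrientation

/-- The framings of the oriented surface `(M, o)`, written as maps `TM → ℝ²`. -/
def Framing {M : Type*} [TopologicalSpace M] [ChartedSpace (EuclideanHalfSpace 2) M]
    [IsManifold (𝓡∂ 2) ∞ M] (o : SurfaceOrientation M) : Type _ :=
  {f : C(TangentBundle (𝓡∂ 2) M, Plane) // IsFraming o f}

/-- Two framings are homotopic if they are joined by a homotopy through framings. -/
def Framing.Homotopic {M : Type*} [TopologicalSpace M] [ChartedSpace (EuclideanHalfSpace 2) M]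
    [IsManifold (𝓡∂ 2) ∞ M] {o : SurfaceOrientation M} (f₁ f₂ : Framing o) : Prop :=
  ContinuousMap.HomotopicWith f₁.1 f₂.1 (IsFraming o)

/-- Homotopy is an equivalence relation on framings. -/
def Framing.setoid {M : Type*} [TopologicalSpace M] [ChartedSpace (EuclideanHalfSpace 2) M]
    [IsManifold (𝓡∂ 2) ∞ M] (o : SurfaceOrientation M) : Setoid (Framing o) where
  r := Framing.Homotopic
  iseqv :=
    { refl := fun f => ContinuousMap.HomotopicWith.refl f.1 f.2
      symm := fun h => ContinuousMap.HomotopicWith.symm h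
      trans := fun h₁ h₂ => ContinuousMap.HomotopicWith.trans h₁ h₂ }

/-- The set `F(M)` of homotopy classes of framings. -/
def FramingClass {M : Type*} [TopologicalSpace M] [ChartedSpace (EuclideanHalfSpace 2) M]
    [IsManifold (𝓡∂ 2) ∞ M] (o : SurfaceOrientation M) : Type _ :=
  Quotient (Framing.setoid o)

/-- The homotopy class of a framing. -/
def Framing.homotopyClass {M : Type*} [TopologicalSpace M] [ChartedSpace (EuclideanHalfSpace 2) M]
    [IsManifold (𝓡∂ 2) ∞ M] {o : SurfaceOrientation M} (f : Framing o) : FramingClass o :=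
  Quotient.mk (Framing.setoid o) f

/-! ### Rotation numbers -/

/-- The continuous function `θ` measures, in full turns, the angle of the plane curve `c`. -/
def IsAngleOf (c : ℝ → Plane) (θ : ℝ → ℝ) : Prop :=
  Continuous θ ∧ ∀ t, c t 0 = ‖c t‖ * Real.cos (2 * Real.pi * θ t) ∧
    c t 1 = ‖c t‖ * Real.sin (2 * Real.pi * θ t)

/-- The `1`-periodic plane curve `c` turns `k` times around the origin, that is, `c / ‖c‖` has
degree `k` as a map from `ℝ/ℤ` to the unit circle. -/
def TurnsAround (c : ℝ → Plane) (k : ℤ) : Prop :=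
  ∃ θ : ℝ → ℝ, IsAngleOf c θ ∧ ∀ t, θ (t + 1) = θ t + k

open Classical in
/-- The degree of `c / ‖c‖` for a nowhere vanishing `1`-periodic continuous plane curve `c`. -/
noncomputable def turningDegree (c : ℝ → Plane) : ℤ :=
  if h : ∃ k : ℤ, TurnsAround c k then h.choose else 0

/-- A smooth immersion of the circle `ℝ/ℤ` into the surface, as a `1`-periodic map on `ℝ`. -/
structure ImmersedLoop (M : Type*) [TopologicalSpace M]
    [ChartedSpace (EuclideanHalfSpace 2) M] [IsManifold (𝓡∂ 2) ∞ M] where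
  toFun : ℝ → M
  smooth : ContMDiff 𝓘(ℝ, ℝ) (𝓡∂ 2) ∞ toFun
  periodic : ∀ t, toFun (t + 1) = toFun t
  velocity_ne_zero : ∀ t, mfderiv 𝓘(ℝ, ℝ) (𝓡∂ 2) toFun t (1 : ℝ) ≠ 0

/-- The velocity vector of an immersed loop. -/
noncomputable def ImmersedLoop.velocity {M : Type*} [TopologicalSpace M]
    [ChartedSpace (EuclideanHalfSpace 2) M] [IsManifold (𝓡∂ 2) ∞ M] (γ : ImmersedLoop M) (t : ℝ) :
    TangentSpace (𝓡∂ 2) (γ.toFun t) :=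
  mfderiv 𝓘(ℝ, ℝ) (𝓡∂ 2) γ.toFun t (1 : ℝ)

/-- The velocity of the loop `γ`, read in `ℝ²` through the framing `f`. -/
noncomputable def Framing.velocityCurve {M : Type*} [TopologicalSpace M]
    [ChartedSpace (EuclideanHalfSpace 2) M] [IsManifold (𝓡∂ 2) ∞ M] {o : SurfaceOrientation M}
    (f : Framing o) (γ : ImmersedLoop M) (t : ℝ) : Plane :=
  f.1 ⟨γ.toFun t, γ.velocity t⟩

/-- The rotation number of the immersed loop `γ` with respect to the framing `f`. -/
noncomputable def Framing.rot {M : Type*} [TopologicalSpace M]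
    [ChartedSpace (EuclideanHalfSpace 2) M] [IsManifold (𝓡∂ 2) ∞ M] {o : SurfaceOrientation M}
    (f : Framing o) (γ : ImmersedLoop M) : ℤ :=
  turningDegree (f.velocityCurve γ)

/-! The next lemmas show that the rotation number is well defined. -/

theorem TurnsAround.unique {c : ℝ → Plane} (hc : ∀ t, c t ≠ 0) {k l : ℤ}
    (hk : TurnsAround c k) (hl : TurnsAround c l) : k = l := by
  obtain ⟨θ, ⟨hθ, h1⟩, h2⟩ := hk
  obtain ⟨η, ⟨hη, h3⟩, h4⟩ := hl
  have key : ∀ t, ∃ n : ℤ, θ t - η t = n := by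
    intro t
    have hn : ‖c t‖ ≠ 0 := norm_ne_zero_iff.mpr (hc t)
    have hcos : Real.cos (2 * Real.pi * θ t) = Real.cos (2 * Real.pi * η t) :=
      mul_left_cancel₀ hn ((h1 t).1.symm.trans (h3 t).1)
    have hsin : Real.sin (2 * Real.pi * θ t) = Real.sin (2 * Real.pi * η t) :=
      mul_left_cancel₀ hn ((h1 t).2.symm.trans (h3 t).2)
    have hang : Real.cos (2 * Real.pi * θ t - 2 * Real.pi * η t) = 1 := by
      rw [Real.cos_sub, hcos, hsin]
      nlinarith [Real.sin_sq_add_cos_sq (2 * Real.pi * η t)]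
    obtain ⟨n, hn'⟩ := (Real.cos_eq_one_iff _).mp hang
    refine ⟨n, ?_⟩
    have hpi := Real.pi_pos
    have : 2 * Real.pi * (θ t - η t) = 2 * Real.pi * n := by linarith
    exact mul_left_cancel₀ (by positivity) this
  choose N hN using key
  have hNc : Continuous N := by
    rw [Int.isClosedEmbedding_coe_real.isEmbedding.continuous_iff]
    have : ((fun n : ℤ => (n : ℝ)) ∘ N) = fun t => θ t - η t := by
      funext t
      exact (hN t).symm
    rw [this]
    exact hθ.sub hη
  have hconst : N 1 = N 0 := PreconnectedSpace.constant inferInstance hNc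
  have e0 := hN 0
  have e1 := hN 1
  have a := h2 0
  have b := h4 0
  rw [zero_add] at a b
  rw [hconst] at e1
  have : (k : ℝ) = l := by linarith
  exact_mod_cast this

theorem exists_turnsAround {c : ℝ → Plane} (hcont : Continuous c) (hc : ∀ t, c t ≠ 0)
    (hper : ∀ t, c (t + 1) = c t) : ∃ k : ℤ, TurnsAround c k := by
  let z : ℝ → ℂ := fun t => ⟨c t 0, c t 1⟩
  have hz : Continuous z := by
    have : z = fun t => ((c t 0 : ℝ) : ℂ) + ((c t 1 : ℝ) : ℂ) * Complex.I := by
      funext t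
      apply Complex.ext <;> simp [z]
    rw [this]
    fun_prop
  have hnorm : ∀ t, ‖z t‖ = ‖c t‖ := by
    intro t
    rw [EuclideanSpace.norm_eq, Complex.norm_def, Complex.normSq_apply]
    congr 1
    simp [z, Fin.sum_univ_two, sq]
  have hn : ∀ t, ‖c t‖ ≠ 0 := fun t => norm_ne_zero_iff.mpr (hc t)
  have hz0 : ∀ t, z t ≠ 0 := fun t => norm_ne_zero_iff.mp (by rw [hnorm]; exact hn t)
  let u : C(ℝ, Circle) :=
    ⟨fun t => ⟨z t / (‖z t‖ : ℂ), by
      rw [← SetLike.mem_coe, Submonoid.coe_unitSphere, mem_sphere_zero_iff_norm, norm_div, Complex.norm_real, norm_norm]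
      exact div_self (norm_ne_zero_iff.mpr (hz0 t))⟩, by
      refine Continuous.subtype_mk ?_ _
      refine hz.div (by fun_prop) fun t => ?_
      exact_mod_cast norm_ne_zero_iff.mpr (hz0 t)⟩
  obtain ⟨a, ha⟩ : ∃ a : ℝ, Circle.exp a = u 0 := ⟨_, Circle.exp_arg (u 0)⟩
  obtain ⟨F, ⟨-, hF⟩, -⟩ :=
    Circle.isCoveringMap_exp.existsUnique_continuousMap_lifts u (a₀ := 0) (e₀ := a) ha
  have hpi := Real.pi_pos
  have hF' : ∀ t, (Complex.exp (F t * Complex.I)) = z t / (‖z t‖ : ℂ) := by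
    intro t
    have := congrFun hF t
    have := congrArg (fun w : Circle => (w : ℂ)) this
    rw [← Circle.coe_exp]
    exact this
  have hexp : ∀ t, z t = ‖c t‖ * Complex.exp (F t * Complex.I) := by
    intro t
    rw [hF' t, hnorm t]
    have : (‖c t‖ : ℂ) ≠ 0 := by exact_mod_cast hn t
    field_simp
  let θ : ℝ → ℝ := fun t => F t / (2 * Real.pi)
  have hθ : ∀ t, 2 * Real.pi * θ t = F t := fun t => by
    simp only [θ]
    field_simp
  have hang : IsAngleOf c θ := by
    refine ⟨F.continuous.div_const _, fun t => ?_⟩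
    rw [hθ]
    have h := hexp t
    constructor
    · have := congrArg Complex.re h
      rwa [Complex.re_ofReal_mul, Complex.exp_ofReal_mul_I_re] at this
    · have := congrArg Complex.im h
      rwa [Complex.im_ofReal_mul, Complex.exp_ofReal_mul_I_im] at this
  have key : ∀ t, ∃ n : ℤ, θ (t + 1) - θ t = n := by
    intro t
    obtain ⟨a1, a2⟩ := hang.2 t
    obtain ⟨b1, b2⟩ := hang.2 (t + 1)
    rw [hper] at b1 b2
    have hcos := mul_left_cancel₀ (hn t) (b1.symm.trans a1)
    have hsin := mul_left_cancel₀ (hn t) (b2.symm.trans a2)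
    have hone : Real.cos (2 * Real.pi * θ (t + 1) - 2 * Real.pi * θ t) = 1 := by
      rw [Real.cos_sub, hcos, hsin]
      nlinarith [Real.sin_sq_add_cos_sq (2 * Real.pi * θ t)]
    obtain ⟨n, hn'⟩ := (Real.cos_eq_one_iff _).mp hone
    refine ⟨n, ?_⟩
    have : 2 * Real.pi * (θ (t + 1) - θ t) = 2 * Real.pi * n := by linarith
    exact mul_left_cancel₀ (by positivity) this
  choose N hN using key
  have hNc : Continuous N := by
    rw [Int.isClosedEmbedding_coe_real.isEmbedding.continuous_iff]
    have : ((fun n : ℤ => (n : ℝ)) ∘ N) = fun t => θ (t + 1) - θ t := by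
      funext t
      exact (hN t).symm
    rw [this]
    have := hang.1
    fun_prop
  refine ⟨N 0, θ, hang, fun t => ?_⟩
  have hconst : N t = N 0 := PreconnectedSpace.constant inferInstance hNc
  have := hN t
  rw [hconst] at this
  linarith

theorem ImmersedLoop.continuous_velocity {M : Type*} [TopologicalSpace M]
    [ChartedSpace (EuclideanHalfSpace 2) M] [IsManifold (𝓡∂ 2) ∞ M] (γ : ImmersedLoop M) :
    Continuous fun t => (⟨γ.toFun t, γ.velocity t⟩ : TangentBundle (𝓡∂ 2) M) := by
  have h1 := γ.smooth.continuous_tangentMap (by simp)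
  have h2 : Continuous fun t : ℝ => (⟨t, (1 : ℝ)⟩ : TangentBundle 𝓘(ℝ, ℝ) ℝ) := by
    have := (tangentBundleModelSpaceHomeomorph 𝓘(ℝ, ℝ)).symm.continuous
    exact this.comp (by fun_prop : Continuous fun t : ℝ => ((t, (1 : ℝ)) : ModelProd ℝ ℝ))
  exact h1.comp h2

theorem Framing.turnsAround_rot {M : Type*} [TopologicalSpace M]
    [ChartedSpace (EuclideanHalfSpace 2) M] [IsManifold (𝓡∂ 2) ∞ M] {o : SurfaceOrientation M}
    (f : Framing o) (γ : ImmersedLoop M) : TurnsAround (f.velocityCurve γ) (f.rot γ) := by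
  have h : ∃ k : ℤ, TurnsAround (f.velocityCurve γ) k := by
    refine exists_turnsAround (f.1.continuous.comp γ.continuous_velocity) ?_ ?_
    · intro t ht
      obtain ⟨e, he, -⟩ := f.2 (γ.toFun t)
      rw [Framing.velocityCurve, he] at ht
      exact γ.velocity_ne_zero t ((LinearEquiv.map_eq_zero_iff e).mp ht)
    · intro t
      have hp : (⟨γ.toFun (t + 1), γ.velocity (t + 1)⟩ : TangentBundle (𝓡∂ 2) M) =
          ⟨γ.toFun t, γ.velocity t⟩ := by
        have hτ : MDifferentiable 𝓘(ℝ, ℝ) 𝓘(ℝ, ℝ) fun s : ℝ => s + 1 :=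
          (differentiable_id.add_const 1).mdifferentiable
        have hγ : MDifferentiable 𝓘(ℝ, ℝ) (𝓡∂ 2) γ.toFun := γ.smooth.mdifferentiable (by simp)
        have hcomp : γ.toFun ∘ (fun s : ℝ => s + 1) = γ.toFun := funext γ.periodic
        have h1 := tangentMap_comp_at (I := 𝓘(ℝ, ℝ)) (I' := 𝓘(ℝ, ℝ)) (I'' := 𝓡∂ 2)
          (g := γ.toFun) (f := fun s : ℝ => s + 1) ⟨t, (1 : ℝ)⟩ (hγ _) (hτ _)
        have h2 : tangentMap 𝓘(ℝ, ℝ) 𝓘(ℝ, ℝ) (fun s : ℝ => s + 1) ⟨t, (1 : ℝ)⟩ =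
            ⟨t + 1, (1 : ℝ)⟩ := by
          simp [tangentMap, mfderiv_eq_fderiv]
          rfl
        rw [hcomp, h2] at h1
        exact h1.symm
      exact congrArg f.1 hp
  rw [Framing.rot, turningDegree, dif_pos h]
  exact h.choose_spec

/-! ### The boundary -/

/-- The tangent vector `v` at a boundary point `x` points out of the surface: its component normal
to the boundary of the half plane `{y | 0 ≤ y 0}` is negative in the chart at `x`. -/
def IsOutward {M : Type*} [TopologicalSpace M] [ChartedSpace (EuclideanHalfSpace 2) M]
    [IsManifold (𝓡∂ 2) ∞ M] (x : M) (v : TangentSpace (𝓡∂ 2) x) : Prop :=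
  (EuclideanSpace.proj (0 : Fin 2) : Plane →L[ℝ] ℝ)
    (mfderiv (𝓡∂ 2) 𝓘(ℝ, Plane) (extChartAt (𝓡∂ 2) x) x v) < 0

/-- A numbering `∂₀M, …, ∂ₙM` of the boundary components of the oriented surface `(M, o)`, each of
them given by a simple closed parametrization that is compatible with the boundary orientation
(outward normal first). The images of the loops are connected, compact and disjoint, and they cover
the boundary, so they are exactly its components. -/
structure BoundaryNumbering {M : Type*} [TopologicalSpace M]
    [ChartedSpace (EuclideanHalfSpace 2) M] [IsManifold (𝓡∂ 2) ∞ M]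
    (o : SurfaceOrientation M) (n : ℕ) where
  loop : Fin (n + 1) → ImmersedLoop M
  simple : ∀ j s t, (loop j).toFun s = (loop j).toFun t → ∃ m : ℤ, s - t = m
  disjoint : ∀ j k, j ≠ k → Disjoint (Set.range (loop j).toFun) (Set.range (loop k).toFun)
  iUnion_range : ⋃ j, Set.range (loop j).toFun = (𝓡∂ 2).boundary M
  oriented : ∀ j t (v : TangentSpace (𝓡∂ 2) ((loop j).toFun t)), IsOutward ((loop j).toFun t) v →
    IsPositiveBasis (o.orient ((loop j).toFun t)) v ((loop j).velocity t)

/-! ### The action of diffeomorphisms -/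

/-- An orientation-preserving diffeomorphism that fixes the boundary pointwise. The mapping class
group is the group of isotopy classes of these. -/
structure BoundaryFixingDiffeo {M : Type*} [TopologicalSpace M]
    [ChartedSpace (EuclideanHalfSpace 2) M] [IsManifold (𝓡∂ 2) ∞ M]
    (o : SurfaceOrientation M) where
  toDiffeo : M ≃ₘ^∞⟮𝓡∂ 2, 𝓡∂ 2⟯ M
  fixes_boundary : ∀ x ∈ (𝓡∂ 2).boundary M, toDiffeo x = x
  orientation_preserving : ∀ x, Orientation.map (Fin 2)
    (toDiffeo.mfderivToContinuousLinearEquiv (by simp) x).toLinearEquiv (o.orient x) =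
      o.orient (toDiffeo x)

/-- The right action of diffeomorphisms on framings, `f ↦ f ∘ dφ`. -/
noncomputable def Framing.pullback {M : Type*} [TopologicalSpace M]
    [ChartedSpace (EuclideanHalfSpace 2) M] [IsManifold (𝓡∂ 2) ∞ M] {o : SurfaceOrientation M}
    (f : Framing o) (φ : BoundaryFixingDiffeo o) : Framing o :=
  ⟨f.1.comp ⟨tangentMap (𝓡∂ 2) (𝓡∂ 2) φ.toDiffeo,
      φ.toDiffeo.contMDiff.continuous_tangentMap (by simp)⟩, by
    intro x
    obtain ⟨e, he, ho⟩ := f.2 (φ.toDiffeo x)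
    refine ⟨(φ.toDiffeo.mfderivToContinuousLinearEquiv (by simp) x).toLinearEquiv.trans e,
      fun v => he _, ?_⟩
    rw [← ho, ← φ.orientation_preserving x, orientation_map_trans]⟩

/-!
The surface is embedded in the plane as the unit disc with holes, by an orientation-preserving
map `Φ : M → ℂ` (`IsGenusZero.exists_isHoledDiscEmbedding`; a reflection repairs the orientation).
In the trivialization `dΦ` of the tangent bundle a framing is an orientation-preserving real-linear
map `z ↦ a z + b z̄` depending on the point, and such a map preserves the orientation exactly if
`‖b‖ < ‖a‖`. The second coefficient is therefore irrelevant up to homotopy, and framings are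
classified by the nowhere vanishing function `a` up to homotopy. Multiplying `a` by `exp (s g)` for
`0 ≤ s ≤ 1` shows that two framings are homotopic if the quotient of their first coefficients has a
continuous logarithm `g` (`HasCoefficients.homotopic`).

The rotation number of a loop `γ` is the winding number of `a ∘ γ` plus the turning number of the
plane curve `Φ ∘ γ` (`HasCoefficients.rot_eq`). For the boundary loops the latter is known. A vector
pointing out of `M` is mapped to a direction along which one leaves `Φ(M)`, so each boundary loop
moves along one circle in a fixed sense; being simple, it runs around it exactly once
(`exists_angle_of_simple`), counterclockwise on the outer circle and clockwise around the holes. The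
turning numbers are `1` once and `-1` otherwise, and every circle occurs exactly once
(`IsPlanarEmbedding.exists_equiv_runsAround`).

It remains to classify nowhere vanishing functions on a disc with holes by their windings along the
boundary. If there is no winding around the holes, the logarithms on their boundary circles extend
over the holes by Tietze's theorem, so the function extends to the whole disc and has a logarithm
(`exists_log_on_disc_with_holes`). As `∏ (Φ - c i) ^ k i`, with `c i` in hole `i`, winds `-k i` times
along the clockwise boundary of hole `i` and `∑ k i` times along the outer boundary, it follows that
the windings add up to zero, and that all families of integers with sum zero occur.

A diffeomorphism that fixes the boundary pointwise does not change the velocities of the boundary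
loops, so it preserves all boundary rotation numbers, and with them the homotopy class.
-/

/-! ### Logarithms and winding numbers -/

/-- Two continuous logarithms of the same function on a connected space differ by a constant. -/
theorem exists_int_of_exp_eq_exp {X : Type*} [TopologicalSpace X] [PreconnectedSpace X]
    {L₁ L₂ : X → ℂ} (h₁ : Continuous L₁) (h₂ : Continuous L₂)
    (h : ∀ x, Complex.exp (L₁ x) = Complex.exp (L₂ x)) :
    ∃ n : ℤ, ∀ x, L₁ x = L₂ x + n * (2 * Real.pi * Complex.I) := by
  choose N hN using fun x => Complex.exp_eq_exp_iff_exists_int.mp (h x)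
  have hNc : Continuous N := by
    rw [Int.isClosedEmbedding_coe_real.isEmbedding.continuous_iff]
    have : ((fun n : ℤ => (n : ℝ)) ∘ N) =
        fun x => ((L₁ x - L₂ x) / (2 * Real.pi * Complex.I)).re := by
      funext x
      rw [hN x, add_sub_cancel_left, mul_div_cancel_right₀ _ Complex.two_pi_I_ne_zero]
      simp
    rw [this]
    fun_prop
  rcases isEmpty_or_nonempty X with hX | ⟨⟨x₀⟩⟩
  · exact ⟨0, fun x => hX.elim x⟩
  · exact ⟨N x₀, fun x => by rw [hN x, PreconnectedSpace.constant inferInstance hNc]⟩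

/-- The argument lifts through the covering `ℝ → Circle`. -/
theorem exists_continuous_log {X : Type*} [TopologicalSpace X] [SimplyConnectedSpace X]
    [LocallyPathConnectedSpace X] {z : X → ℂ} (hz : Continuous z) (h0 : ∀ x, z x ≠ 0) :
    ∃ L : X → ℂ, Continuous L ∧ ∀ x, Complex.exp (L x) = z x := by
  have hn : ∀ x, (‖z x‖ : ℂ) ≠ 0 := fun x => by exact_mod_cast norm_ne_zero_iff.mpr (h0 x)
  let u : C(X, Circle) :=
    ⟨fun t => ⟨z t / (‖z t‖ : ℂ), by
      rw [← SetLike.mem_coe, Submonoid.coe_unitSphere, mem_sphere_zero_iff_norm, norm_div,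
        Complex.norm_real, norm_norm]
      exact div_self (norm_ne_zero_iff.mpr (h0 t))⟩,
      by
        refine Continuous.subtype_mk ?_ _
        exact hz.div (by fun_prop) hn⟩
  obtain ⟨x₀⟩ : Nonempty X := inferInstance
  obtain ⟨F, ⟨-, hF⟩, -⟩ :=
    Circle.isCoveringMap_exp.existsUnique_continuousMap_lifts u x₀ _ (Circle.exp_arg (u x₀))
  refine ⟨fun x => (Real.log ‖z x‖ : ℝ) + (F x : ℂ) * Complex.I, ?_, fun x => ?_⟩
  · have : Continuous fun x => Real.log ‖z x‖ :=
      hz.norm.log fun x => norm_ne_zero_iff.mpr (h0 x)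
    fun_prop
  · have := congrArg (fun w : Circle => (w : ℂ)) (congrFun hF x)
    have h2 : Complex.exp (F x * Complex.I) = z x / (‖z x‖ : ℂ) := by
      rw [← Circle.coe_exp]
      exact this
    rw [Complex.exp_add, h2, ← Complex.ofReal_exp, Real.exp_log (norm_pos_iff.mpr (h0 x))]
    field_simp [hn x]

/-- The closed curve `z : ℝ/ℤ → ℂ \ {0}` winds `k` times around the origin: it has a continuous
logarithm on `ℝ` that increases by `2πik` over each period. -/
def Winds (z : ℝ → ℂ) (k : ℤ) : Prop :=
  ∃ L : ℝ → ℂ, Continuous L ∧ (∀ t, Complex.exp (L t) = z t) ∧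
    ∀ t, L (t + 1) = L t + k * (2 * Real.pi * Complex.I)

theorem exists_winds {z : ℝ → ℂ} (hz : Continuous z) (h0 : ∀ t, z t ≠ 0)
    (hper : ∀ t, z (t + 1) = z t) : ∃ k, Winds z k := by
  obtain ⟨L, hL, he⟩ := exists_continuous_log hz h0
  obtain ⟨n, hn⟩ := exists_int_of_exp_eq_exp (L₁ := fun t => L (t + 1)) (L₂ := L)
    (by fun_prop) hL (fun t => by rw [he, he, hper])
  exact ⟨n, L, hL, he, hn⟩

theorem Winds.unique {z : ℝ → ℂ} {k l : ℤ} (hk : Winds z k) (hl : Winds z l) : k = l := by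
  obtain ⟨L, hL, he, hp⟩ := hk
  obtain ⟨L', hL', he', hp'⟩ := hl
  obtain ⟨n, hn⟩ := exists_int_of_exp_eq_exp hL hL' (fun t => by rw [he, he'])
  have h1 := hn (0 + 1)
  rw [hp, hp', hn 0] at h1
  have : (k : ℂ) * (2 * Real.pi * Complex.I) = l * (2 * Real.pi * Complex.I) := by
    linear_combination h1
  exact_mod_cast mul_right_cancel₀ Complex.two_pi_I_ne_zero this

theorem Winds.ne_zero {z : ℝ → ℂ} {k : ℤ} (h : Winds z k) (t : ℝ) : z t ≠ 0 := by
  obtain ⟨L, -, he, -⟩ := h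
  rw [← he]
  exact Complex.exp_ne_zero _

theorem Winds.mul {z w : ℝ → ℂ} {k l : ℤ} (hk : Winds z k) (hl : Winds w l) :
    Winds (fun t => z t * w t) (k + l) := by
  obtain ⟨L, hL, he, hp⟩ := hk
  obtain ⟨L', hL', he', hp'⟩ := hl
  refine ⟨fun t => L t + L' t, by fun_prop, fun t => by rw [Complex.exp_add, he, he'],
    fun t => ?_⟩
  simp only [hp, hp']
  push_cast
  ring

theorem Winds.zpow {z : ℝ → ℂ} {k : ℤ} (hk : Winds z k) (n : ℤ) :
    Winds (fun t => z t ^ n) (n * k) := by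
  obtain ⟨L, hL, he, hp⟩ := hk
  refine ⟨fun t => n * L t, by fun_prop, fun t => by rw [Complex.exp_int_mul, he], fun t => ?_⟩
  simp only [hp]
  push_cast
  ring

theorem Winds.prod {ι : Type*} (s : Finset ι) {z : ι → ℝ → ℂ} {k : ι → ℤ}
    (h : ∀ i, Winds (z i) (k i)) : Winds (fun t => ∏ i ∈ s, z i t) (∑ i ∈ s, k i) := by
  choose L hL he hp using h
  refine ⟨fun t => ∑ i ∈ s, L i t, by fun_prop, fun t => by simp [Complex.exp_sum, he],
    fun t => ?_⟩
  simp only [hp, Finset.sum_add_distrib, Int.cast_sum, Finset.sum_mul]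

theorem winds_const {c : ℂ} (hc : c ≠ 0) : Winds (fun _ => c) 0 :=
  ⟨fun _ => Complex.log c, continuous_const, fun _ => Complex.exp_log hc, by simp⟩

/-- A closed curve with a periodic logarithm does not wind around the origin. -/
theorem winds_exp_periodic {h : ℝ → ℂ} (hh : Continuous h) (hp : ∀ t, h (t + 1) = h t) :
    Winds (fun t => Complex.exp (h t)) 0 :=
  ⟨h, hh, fun _ => rfl, by simp [hp]⟩

/-- Within distance `1` of the point `1` the principal branch of the logarithm is continuous. -/
theorem winds_one_add {w : ℝ → ℂ} (hw : Continuous w) (hp : ∀ t, w (t + 1) = w t)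
    (h1 : ∀ t, ‖w t‖ < 1) : Winds (fun t => 1 + w t) 0 := by
  have hs : ∀ t, 1 + w t ∈ Complex.slitPlane := fun t => Complex.mem_slitPlane_of_norm_lt_one (h1 t)
  have := winds_exp_periodic (h := fun t => Complex.log (1 + w t))
    ((continuous_const.add hw).clog hs) (fun t => by rw [hp])
  simpa only [Complex.exp_log (Complex.slitPlane_ne_zero (hs _))] using this

/-- Adding a smaller closed curve does not change the winding number. -/
theorem Winds.add_small {z w : ℝ → ℂ} {k : ℤ} (hz : Winds z k) (hzp : ∀ t, z (t + 1) = z t)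
    (hw : Continuous w) (hp : ∀ t, w (t + 1) = w t) (h : ∀ t, ‖w t‖ < ‖z t‖) :
    Winds (fun t => z t + w t) k := by
  have hz0 : ∀ t, z t ≠ 0 := fun t h0 => by
    have := h t
    rw [h0, norm_zero] at this
    exact absurd this (norm_nonneg _).not_gt
  have hzc : Continuous z := by
    obtain ⟨L, hL, he, -⟩ := hz
    rw [show z = fun t => Complex.exp (L t) from funext fun t => (he t).symm]
    fun_prop
  have h1 := winds_one_add (w := fun t => w t / z t) (hw.div hzc hz0) (fun t => by rw [hp, hzp])
    (fun t => by
      rw [norm_div, div_lt_one (norm_pos_iff.mpr (hz0 t))]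
      exact h t)
  have h2 := hz.mul h1
  rw [add_zero] at h2
  convert h2 using 2 with t
  field_simp [hz0 t]

/-- Homotopy invariance of the winding number. -/
theorem Winds.homotopy {Z : ℝ × ℝ → ℂ} (hZ : Continuous Z) (h0 : ∀ p, Z p ≠ 0)
    (hp : ∀ s t, Z (s, t + 1) = Z (s, t)) {k : ℤ} (s s' : ℝ)
    (hk : Winds (fun t => Z (s, t)) k) : Winds (fun t => Z (s', t)) k := by
  obtain ⟨L, hL, he⟩ := exists_continuous_log hZ h0
  obtain ⟨n, hn⟩ := exists_int_of_exp_eq_exp (L₁ := fun p : ℝ × ℝ => L (p.1, p.2 + 1)) (L₂ := L)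
    (by fun_prop) hL (fun p => by rw [he, he, hp])
  have hall : ∀ s, Winds (fun t => Z (s, t)) n := fun s =>
    ⟨fun t => L (s, t), by fun_prop, fun t => he _, fun t => hn (s, t)⟩
  rw [hk.unique (hall s)]
  exact hall s'

/-- Reparametrization by a circle map of degree `d` multiplies the winding number by `d`. -/
theorem Winds.comp_degree {z : ℝ → ℂ} {k : ℤ} (hz : Winds z k) {θ : ℝ → ℝ} (hθ : Continuous θ)
    {d : ℤ} (hd : ∀ t, θ (t + 1) = θ t + d) : Winds (fun t => z (θ t)) (d * k) := by
  obtain ⟨L, hL, he, hp⟩ := hz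
  refine ⟨fun t => L (θ t), by fun_prop, fun t => he _, fun t => ?_⟩
  have key : Function.Periodic (fun x : ℝ => L x - k * (2 * Real.pi * Complex.I) * x) 1 := by
    intro x
    simp only [hp]
    push_cast
    ring
  have := key.int_mul d (θ t)
  simp only [mul_one] at this
  simp only [hd]
  push_cast at this ⊢
  linear_combination this

/-- The standard parametrization of a circle of radius `r` about `c`. -/
noncomputable def circlePoint (c : ℂ) (r : ℝ) (s : ℝ) : ℂ :=
  c + r * Complex.exp (2 * Real.pi * s * Complex.I)

theorem continuous_circlePoint (c : ℂ) (r : ℝ) : Continuous (circlePoint c r) := by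
  unfold circlePoint
  fun_prop

theorem circlePoint_add_one (c : ℂ) (r s : ℝ) : circlePoint c r (s + 1) = circlePoint c r s := by
  unfold circlePoint
  congr 2
  rw [Complex.exp_eq_exp_iff_exists_int]
  exact ⟨1, by push_cast; ring⟩

theorem norm_circlePoint_sub (c : ℂ) {r : ℝ} (hr : 0 ≤ r) (s : ℝ) :
    ‖circlePoint c r s - c‖ = r := by
  have : Complex.exp (2 * Real.pi * s * Complex.I) =
      Complex.exp ((2 * Real.pi * s : ℝ) * Complex.I) := by push_cast; rfl
  rw [circlePoint, add_sub_cancel_left, norm_mul, this, Complex.norm_exp_ofReal_mul_I, mul_one,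
    Complex.norm_real, Real.norm_of_nonneg hr]

theorem exists_circlePoint_eq {c z : ℂ} {r : ℝ} (hr : ‖z - c‖ = r) :
    ∃ s, circlePoint c r s = z := by
  refine ⟨Complex.arg (z - c) / (2 * Real.pi), ?_⟩
  have hpi : (2 * Real.pi : ℂ) ≠ 0 := by
    simp [Real.pi_ne_zero]
  have : (2 * Real.pi * ((Complex.arg (z - c) / (2 * Real.pi) : ℝ) : ℂ) * Complex.I) =
      Complex.arg (z - c) * Complex.I := by
    push_cast
    field_simp
  rw [circlePoint, this, ← hr, Complex.norm_mul_exp_arg_mul_I]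
  ring

theorem winds_circlePoint_sub (c : ℂ) {r : ℝ} (hr : 0 < r) {θ : ℝ → ℝ} (hθ : Continuous θ) {d : ℤ}
    (hd : ∀ t, θ (t + 1) = θ t + d) : Winds (fun t => circlePoint c r (θ t) - c) d := by
  refine ⟨fun t => Complex.log r + 2 * Real.pi * θ t * Complex.I, by fun_prop, fun t => ?_,
    fun t => ?_⟩
  · rw [Complex.exp_add, Complex.exp_log (by exact_mod_cast hr.ne')]
    simp only [circlePoint]
    ring
  · simp only [hd]
    push_cast
    ring

/-- A function without winding along a circle has a continuous logarithm there, which extends to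
the plane. -/
theorem exists_log_extension_of_winds_zero {b : ℂ → ℂ} {c : ℂ} {r : ℝ} (hr : 0 < r)
    (hb : Winds (fun s => b (circlePoint c r s)) 0) :
    ∃ H : ℂ → ℂ, Continuous H ∧ ∀ z, ‖z - c‖ = r → Complex.exp (H z) = b z := by
  obtain ⟨L, hL, he, hp⟩ := hb
  have hper : Function.Periodic L 1 := fun t => by rw [hp]; simp
  let l : C(AddCircle (1 : ℝ), ℂ) := ⟨hper.lift, by
    exact hL.quotient_lift _⟩
  let e : AddCircle (1 : ℝ) → ℂ := fun x =>
    c + r * (AddCircle.homeomorphCircle (one_ne_zero) x : ℂ)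
  have hec : Continuous e := by fun_prop
  have hinj : Function.Injective e := by
    intro x y hxy
    have h1 : (r : ℂ) ≠ 0 := by exact_mod_cast hr.ne'
    have h2 := mul_left_cancel₀ h1 (add_left_cancel hxy)
    exact (AddCircle.homeomorphCircle (one_ne_zero)).injective (Subtype.ext h2)
  obtain ⟨g, hg⟩ := l.exists_extension' (hec.isClosedEmbedding hinj)
  refine ⟨g, g.continuous, fun z hz => ?_⟩
  obtain ⟨s, rfl⟩ := exists_circlePoint_eq hz
  have h1 : e (s : AddCircle (1 : ℝ)) = circlePoint c r s := by
    simp only [e, circlePoint]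
    rw [AddCircle.homeomorphCircle_apply, AddCircle.toCircle_apply_mk, Circle.coe_exp]
    push_cast
    simp
  have h2 : g (circlePoint c r s) = L s := by
    rw [← h1]
    exact congrFun hg (s : AddCircle (1 : ℝ))
  rw [h2, he]

/-- A nowhere vanishing function on a disc with holes that does not wind around any of the holes has
a continuous logarithm: its logarithms on the boundaries of the holes extend over the holes, so it
extends to a nowhere vanishing function on the whole disc, which is simply connected. -/
theorem exists_log_on_disc_with_holes {ι : Type*} [Finite ι] {c : ι → ℂ} {r : ι → ℝ}
    (hr : ∀ i, 0 < r i)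
    (hdisj : ∀ i j, i ≠ j → Disjoint (Metric.closedBall (c i) (r i)) (Metric.closedBall (c j) (r j)))
    {b : ℂ → ℂ} (hb : Continuous b)
    (h0 : ∀ z ∈ Metric.closedBall (0 : ℂ) 1 \ ⋃ i, Metric.ball (c i) (r i), b z ≠ 0)
    (hw : ∀ i, Winds (fun s => b (circlePoint (c i) (r i) s)) 0) :
    ∃ h : ℂ → ℂ, Continuous h ∧
      ∀ z ∈ Metric.closedBall (0 : ℂ) 1 \ ⋃ i, Metric.ball (c i) (r i), Complex.exp (h z) = b z := by
  classical
  choose H hH he using fun i => exists_log_extension_of_winds_zero (hr i) (hw i)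
  have huniq : ∀ {i j z}, z ∈ Metric.closedBall (c i) (r i) → z ∈ Metric.closedBall (c j) (r j) →
      i = j := fun {i j z} hi hj => by
    by_contra hij
    exact Set.disjoint_left.mp (hdisj i j hij) hi hj
  let G : ℂ → ℂ := fun z =>
    if hz : ∃ i, z ∈ Metric.ball (c i) (r i) then Complex.exp (H hz.choose z) else b z
  have hGD : ∀ z, (∀ i, z ∉ Metric.ball (c i) (r i)) → G z = b z := fun z hz =>
    dif_neg (not_exists.mpr hz)
  have hGi : ∀ i, ∀ z ∈ Metric.closedBall (c i) (r i), G z = Complex.exp (H i z) := by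
    intro i z hz
    by_cases hz' : ∃ j, z ∈ Metric.ball (c j) (r j)
    · have : hz'.choose = i := huniq (Metric.ball_subset_closedBall hz'.choose_spec) hz
      simp only [G, dif_pos hz']
      rw [this]
    · rw [hGD z (not_exists.mp hz'), he]
      have h1 : ¬ z ∈ Metric.ball (c i) (r i) := fun h => hz' ⟨i, h⟩
      rw [mem_ball_iff_norm, not_lt] at h1
      exact le_antisymm (mem_closedBall_iff_norm.mp hz) h1
  let S : Option ι → Set ℂ := fun o =>
    o.elim (Metric.closedBall 0 1 \ ⋃ i, Metric.ball (c i) (r i))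
      (fun i => Metric.closedBall (c i) (r i))
  have hcover : ∀ z ∈ Metric.closedBall (0 : ℂ) 1, z ∈ ⋃ o, S o := by
    intro z hz
    by_cases hz' : ∃ j, z ∈ Metric.ball (c j) (r j)
    · obtain ⟨j, hj⟩ := hz'
      exact Set.mem_iUnion.mpr ⟨some j, Metric.ball_subset_closedBall hj⟩
    · exact Set.mem_iUnion.mpr ⟨none, hz, by simpa using hz'⟩
  have hGc : ContinuousOn G (⋃ o, S o) := by
    refine (locallyFinite_of_finite S).continuousOn_iUnion ?_ ?_
    · rintro (_ | i)
      · exact Metric.isClosed_closedBall.sdiff (isOpen_iUnion fun i => Metric.isOpen_ball)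
      · exact Metric.isClosed_closedBall
    · rintro (_ | i)
      · refine hb.continuousOn.congr fun z hz => hGD z fun i hi => hz.2 (Set.mem_iUnion.mpr ⟨i, hi⟩)
      · exact (Complex.continuous_exp.comp (hH i)).continuousOn.congr fun z hz => hGi i z hz
  have hG0 : ∀ z ∈ Metric.closedBall (0 : ℂ) 1, G z ≠ 0 := by
    intro z hz
    by_cases hz' : ∃ j, z ∈ Metric.ball (c j) (r j)
    · obtain ⟨j, hj⟩ := hz'
      rw [hGi j z (Metric.ball_subset_closedBall hj)]
      exact Complex.exp_ne_zero _
    · rw [hGD z (not_exists.mp hz')]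
      exact h0 z ⟨hz, by simpa using hz'⟩
  -- The radial retraction of the plane onto the closed disc.
  let ρ : ℂ → ℂ := fun z => ((max 1 ‖z‖)⁻¹ : ℝ) * z
  have hpos : ∀ z : ℂ, 0 < max 1 ‖z‖ := fun z => lt_max_of_lt_left one_pos
  have hρc : Continuous ρ := by
    have : Continuous fun z : ℂ => (max 1 ‖z‖)⁻¹ :=
      (continuous_const.max continuous_norm).inv₀ fun z => (hpos z).ne'
    fun_prop
  have hρ : ∀ z, ρ z ∈ Metric.closedBall (0 : ℂ) 1 := fun z => by
    rw [mem_closedBall_zero_iff, norm_mul, Complex.norm_real, norm_inv,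
      Real.norm_of_nonneg (hpos z).le, inv_mul_le_iff₀ (hpos z), mul_one]
    exact le_max_right _ _
  obtain ⟨L, hL, hLe⟩ := exists_continuous_log (z := fun z => G (ρ z))
    (hGc.comp_continuous hρc fun z => hcover _ (hρ z)) (fun z => hG0 _ (hρ z))
  refine ⟨L, hL, fun z hz => ?_⟩
  have : ρ z = z := by
    simp only [ρ]
    rw [max_eq_left (mem_closedBall_zero_iff.mp hz.1)]
    simp
  rw [hLe, this, hGD z fun i hi => hz.2 (Set.mem_iUnion.mpr ⟨i, hi⟩)]

/-- A curve on the circle of radius `r` about `c` winds around every point `p` of the open disc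
bounded by the circle as often as around the centre. -/
theorem Winds.sub_of_mem_ball {z : ℝ → ℂ} {c p : ℂ} {r : ℝ} {k : ℤ}
    (hz : Winds (fun t => z t - c) k) (hp : ∀ t, z (t + 1) = z t) (hr : ∀ t, ‖z t - c‖ = r)
    (h : ‖p - c‖ < r) : Winds (fun t => z t - p) k := by
  have := hz.add_small (w := fun _ => c - p) (fun t => by rw [hp]) continuous_const
    (fun _ => rfl) (fun t => by rw [hr, norm_sub_rev]; exact h)
  simpa using this

theorem winds_sub_of_not_mem_closedBall {z : ℝ → ℂ} {c p : ℂ} {r : ℝ} (hz : Continuous z)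
    (hp : ∀ t, z (t + 1) = z t) (hr : ∀ t, ‖z t - c‖ = r) (h : r < ‖p - c‖) :
    Winds (fun t => z t - p) 0 := by
  have hne : c - p ≠ 0 := by
    rw [← norm_ne_zero_iff, norm_sub_rev]
    have := norm_nonneg (z 0 - c)
    rw [hr] at this
    linarith
  have := (winds_const hne).add_small (w := fun t => z t - c) (fun t => rfl) (by fun_prop)
    (fun t => by rw [hp]) (fun t => by rw [hr, norm_sub_rev]; exact h)
  simpa using this

/-- A continuous logarithm of a differentiable curve is differentiable. -/
theorem hasDerivAt_of_exp_eq {L u : ℝ → ℂ} (hL : Continuous L) (he : ∀ t, Complex.exp (L t) = u t)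
    {t : ℝ} {u' : ℂ} (hu : HasDerivAt u u' t) : HasDerivAt L (u' / u t) t := by
  have h0 : u t ≠ 0 := by rw [← he]; exact Complex.exp_ne_zero _
  have h1 : HasDerivAt (fun s => Complex.log (u s / u t) + L t) (u' / u t) t := by
    have h2 := (hu.div_const (u t)).clog_real (by rw [div_self h0]; simp)
    rw [div_self h0, div_one] at h2
    exact h2.add_const _
  refine h1.congr_of_eventuallyEq ?_
  have hc : Continuous fun s => (L s - L t).im := by fun_prop
  have hmem : Set.Ioo (-Real.pi) Real.pi ∈ 𝓝 ((fun s => (L s - L t).im) t) := by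
    simp only [sub_self, Complex.zero_im]
    exact Ioo_mem_nhds (by linarith [Real.pi_pos]) Real.pi_pos
  filter_upwards [hc.continuousAt.preimage_mem_nhds hmem] with s hs
  rw [← he s, ← he t, ← Complex.exp_sub, Complex.log_exp hs.1 hs.2.le, sub_add_cancel]

/-- A simple closed curve on a circle that moves strictly in the positive (`ε = 1`) or negative
(`ε = -1`) direction runs exactly once around the circle, in that direction. -/
theorem exists_angle_of_simple {z z' : ℝ → ℂ} {c : ℂ} {r : ℝ} {ε : ℤ} (hε : ε = 1 ∨ ε = -1)
    (hr : 0 < r) (hz : ∀ t, HasDerivAt z (z' t) t) (hp : ∀ t, z (t + 1) = z t)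
    (hcirc : ∀ t, ‖z t - c‖ = r) (hdir : ∀ t, 0 < ε * (z' t / (z t - c)).im)
    (hsimple : ∀ s t, z s = z t → ∃ m : ℤ, s - t = m) :
    ∃ θ : ℝ → ℝ, Continuous θ ∧ (∀ t, θ (t + 1) = θ t + ε) ∧ (∀ t, z t = circlePoint c r (θ t)) ∧
      ∀ s, ∃ t, circlePoint c r s = z t := by
  have hzc : Continuous z := continuous_iff_continuousAt.mpr fun t => (hz t).continuousAt
  have hne : ∀ t, z t - c ≠ 0 := fun t => norm_ne_zero_iff.mp (by rw [hcirc]; exact hr.ne')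
  obtain ⟨k, L, hL, he, hk⟩ := exists_winds (z := fun t => z t - c) (by fun_prop) hne
    (fun t => by rw [hp])
  replace he : ∀ t, Complex.exp (L t) = z t - c := he
  have hpi := Real.pi_pos
  set θ : ℝ → ℝ := fun t => (L t).im / (2 * Real.pi) with hθ
  have hθc : Continuous θ := by fun_prop
  have hθk : ∀ t, θ (t + 1) = θ t + k := fun t => by
    simp only [θ, hk]
    simp
    field_simp
  have hzθ : ∀ t, z t = circlePoint c r (θ t) := fun t => by
    have h1 : (2 * Real.pi * (θ t : ℂ) * Complex.I) = (L t).im * Complex.I := by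
      simp only [θ]
      push_cast
      have : (Real.pi : ℂ) ≠ 0 := by exact_mod_cast hpi.ne'
      field_simp
    have h2 : (r : ℂ) = Complex.exp ((L t).re) := by
      rw [← hcirc t, ← he t, Complex.norm_exp, Complex.ofReal_exp]
    rw [circlePoint, h1, h2, ← Complex.exp_add, Complex.re_add_im, he]
    ring
  have hmono : StrictMono fun t => ε * θ t := by
    refine strictMono_of_hasDerivAt_pos
      (f' := fun t => ε * ((z' t / (z t - c)).im / (2 * Real.pi))) (fun t => ?_) (fun t => ?_)
    · have h1 := hasDerivAt_of_exp_eq hL he ((hz t).sub_const c)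
      have h2 := Complex.imCLM.hasFDerivAt.comp_hasDerivAt t h1
      exact (h2.div_const (2 * Real.pi)).const_mul (ε : ℝ)
    · have := hdir t
      rw [← mul_div_assoc]
      positivity
  have hεε : ε * ε = 1 := by rcases hε with rfl | rfl <;> rfl
  have hεR : (ε : ℝ) * ε = 1 := by exact_mod_cast hεε
  -- The degree has the sign `ε`; if it were not `ε`, some point would be passed twice in a period.
  have hkpos : 0 < ε * k := by
    have := hmono (show (0 : ℝ) < 0 + 1 by norm_num)
    simp only [hθk] at this
    have h2 : (0 : ℝ) < ε * k := by linarith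
    exact_mod_cast h2
  have hk1 : ε * k = 1 := by
    by_contra hne1
    have h2 : (2 : ℤ) ≤ ε * k := by omega
    have h2' : (2 : ℝ) ≤ ε * k := by exact_mod_cast h2
    have hiv := intermediate_value_Icc (f := fun t => ε * θ t) (a := 0) (b := 0 + 1)
      (by norm_num) (by fun_prop)
    obtain ⟨t, -, ht⟩ := hiv (show ε * θ 0 + 1 ∈ _ from
      ⟨by linarith, by simp only [hθk]; linarith⟩)
    have htθ : θ t = θ 0 + ε := by linear_combination ε * ht + (θ 0 - θ t) * hεR
    have hcp : ∀ x : ℝ, circlePoint c r (x + ε) = circlePoint c r x := fun x => by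
      have := (show Function.Periodic (circlePoint c r) 1 from circlePoint_add_one c r).int_mul ε x
      simpa using this
    obtain ⟨m, hm⟩ := hsimple t 0 (by rw [hzθ, hzθ, htθ, hcp])
    have h0t : (0 : ℝ) < t := by
      rw [← hmono.lt_iff_lt]; simp only [ht]; linarith
    have ht1 : t < 0 + 1 := by
      rw [← hmono.lt_iff_lt]; simp only [ht, hθk]; linarith
    rw [sub_zero] at hm
    rw [hm] at h0t ht1
    have ha : 0 < m := by exact_mod_cast h0t
    have hb : m < 1 := by rw [zero_add] at ht1; exact_mod_cast ht1
    omega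
  have hkε : k = ε := by
    have : ε * (ε * k) = ε * 1 := by rw [hk1]
    rw [← mul_assoc, hεε] at this
    linarith
  rw [hkε] at hθk
  refine ⟨θ, hθc, hθk, hzθ, fun s => ?_⟩
  -- Move `s` by an integer into one period of the angle.
  have hiv := intermediate_value_Icc (f := fun t => ε * θ t) (a := 0) (b := 0 + 1)
    (by norm_num) (by fun_prop)
  obtain ⟨t, -, ht⟩ := hiv (show ε * θ 0 + Int.fract (ε * (s - θ 0)) ∈ _ from
    ⟨by linarith [Int.fract_nonneg (ε * (s - θ 0))], by
      simp only [hθk]; linarith [Int.fract_lt_one (ε * (s - θ 0))]⟩)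
  refine ⟨t, ?_⟩
  have hst : s = θ t + (ε * ⌊ε * (s - θ 0)⌋ : ℤ) := by
    have := Int.floor_add_fract (ε * (s - θ 0))
    push_cast
    simp only at ht
    linear_combination (-(ε : ℝ)) * this - ε * ht + (-s + θ t) * hεR
  have := (show Function.Periodic (circlePoint c r) 1 from circlePoint_add_one c r).int_mul
    (ε * ⌊ε * (s - θ 0)⌋) (θ t)
  rw [hzθ, hst, ← this, mul_one]

/-! ### Plane domains bounded by circles -/

/-- `D` is a plane domain bounded by disjoint circles with centres `c κ` and radii `r κ`, lying
inside the circle if `ε κ = 1`, and outside if `ε κ = -1`. -/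
structure IsCircleDomain {ι : Type*} (c : ι → ℂ) (r : ι → ℝ) (ε : ι → ℤ) (D : Set ℂ) : Prop where
  radius_pos : ∀ κ, 0 < r κ
  sign : ∀ κ, ε κ = 1 ∨ ε κ = -1
  mem_iff : ∀ z, z ∈ D ↔ ∀ κ, ε κ * (‖z - c κ‖ - r κ) ≤ 0
  separated : ∀ κ κ', κ ≠ κ' → ∀ z, ‖z - c κ‖ = r κ → ε κ' * (‖z - c κ'‖ - r κ') < 0

namespace IsCircleDomain

variable {ι : Type*} {c : ι → ℂ} {r : ι → ℝ} {ε : ι → ℤ} {D : Set ℂ}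

theorem eq_of_mem_circles (hD : IsCircleDomain c r ε D) {κ κ' : ι} {z : ℂ}
    (h : ‖z - c κ‖ = r κ) (h' : ‖z - c κ'‖ = r κ') : κ = κ' := by
  by_contra hne
  have := hD.separated κ κ' hne z h
  rw [h', sub_self, mul_zero] at this
  exact this.false

theorem mem_of_mem_circle (hD : IsCircleDomain c r ε D) {κ : ι} {z : ℂ} (h : ‖z - c κ‖ = r κ) :
    z ∈ D := by
  rw [hD.mem_iff]
  intro κ'
  by_cases hne : κ = κ'
  · subst hne
    rw [h, sub_self, mul_zero]
  · exact (hD.separated κ κ' hne z h).le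

theorem mem_nhds_of_forall_ne [Finite ι] (hD : IsCircleDomain c r ε D) {z : ℂ} (hz : z ∈ D)
    (h : ∀ κ, ‖z - c κ‖ ≠ r κ) : D ∈ 𝓝 z := by
  have key : ∀ᶠ y in 𝓝 z, ∀ κ, ε κ * (‖y - c κ‖ - r κ) < 0 := by
    rw [Filter.eventually_all]
    intro κ
    have hc : Continuous fun y : ℂ => (ε κ : ℝ) * (‖y - c κ‖ - r κ) := by fun_prop
    refine hc.continuousAt.eventually_lt continuousAt_const ?_
    refine lt_of_le_of_ne ((hD.mem_iff z).mp hz κ) ?_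
    have h1 : ‖z - c κ‖ - r κ ≠ 0 := sub_ne_zero.mpr (h κ)
    have h2 : (ε κ : ℝ) ≠ 0 := by rcases hD.sign κ with h | h <;> simp [h]
    exact mul_ne_zero h2 h1
  filter_upwards [key] with y hy
  exact (hD.mem_iff y).mpr fun κ => (hy κ).le

theorem not_mem_nhds_of_mem_circle (hD : IsCircleDomain c r ε D) {κ : ι} {z : ℂ}
    (h : ‖z - c κ‖ = r κ) : D ∉ 𝓝 z := by
  intro hn
  have hc : Continuous fun s : ℝ => z + (s * ε κ : ℝ) * (z - c κ) := by fun_prop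
  have h0 : D ∈ 𝓝 ((fun s : ℝ => z + (s * ε κ : ℝ) * (z - c κ)) 0) := by simpa using hn
  have h1 : ∀ᶠ s in 𝓝 (0 : ℝ), z + (s * ε κ : ℝ) * (z - c κ) ∈ D :=
    hc.continuousAt.preimage_mem_nhds h0
  have h2 : ∀ᶠ s in 𝓝[>] (0 : ℝ), s < 1 :=
    (eventually_lt_nhds one_pos).filter_mono nhdsWithin_le_nhds
  obtain ⟨s, ⟨hs1, hs2⟩, hs3⟩ :=
    (((h1.filter_mono nhdsWithin_le_nhds).and h2).and
      (self_mem_nhdsWithin (s := Set.Ioi (0 : ℝ)))).exists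
  have hs3 : 0 < s := hs3
  have h3 := (hD.mem_iff _).mp hs1 κ
  have h4 : z + (s * ε κ : ℝ) * (z - c κ) - c κ = ((1 + s * ε κ : ℝ) : ℂ) * (z - c κ) := by
    push_cast; ring
  rw [h4, norm_mul, h, Complex.norm_real] at h3
  have hr := hD.radius_pos κ
  have := mul_pos hs3 hr
  rcases hD.sign κ with hκ | hκ
  · rw [hκ, Real.norm_of_nonneg (by push_cast; linarith)] at h3
    push_cast at h3
    nlinarith
  · rw [hκ, Real.norm_of_nonneg (by push_cast; linarith)] at h3
    push_cast at h3
    nlinarith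

/-- A direction `w` at a point of a boundary circle along which one leaves the domain makes a
non-negative angle with the outward normal. -/
theorem nonneg_of_eventually_notMem [Finite ι] (hD : IsCircleDomain c r ε D) {κ : ι} {z w : ℂ}
    (h : ‖z - c κ‖ = r κ) (hw : ∀ᶠ s : ℝ in 𝓝[>] 0, z + s * w ∉ D) :
    0 ≤ ε κ * (starRingEnd ℂ w * (z - c κ)).re := by
  have hother : ∀ᶠ s : ℝ in 𝓝[>] 0, ∀ κ', κ' ≠ κ → ε κ' * (‖z + s * w - c κ'‖ - r κ') < 0 := by
    rw [Filter.eventually_all]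
    intro κ'
    by_cases hne : κ' = κ
    · exact Filter.Eventually.of_forall fun s hs => absurd hne hs
    have hc : Continuous fun s : ℝ => (ε κ' : ℝ) * (‖z + s * w - c κ'‖ - r κ') := by fun_prop
    have h1 := hc.continuousAt.eventually_lt (x₀ := 0) continuousAt_const
      (show (ε κ' : ℝ) * (‖z + (0 : ℝ) * w - c κ'‖ - r κ') < 0 by
        simpa using hD.separated κ κ' (Ne.symm hne) z h)
    filter_upwards [h1.filter_mono nhdsWithin_le_nhds] with s hs _ using hs
  have hpos : ∀ᶠ s : ℝ in 𝓝[>] 0,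
      0 ≤ ε κ * (2 * (starRingEnd ℂ w * (z - c κ)).re + s * ‖w‖ ^ 2) := by
    filter_upwards [hw, hother, self_mem_nhdsWithin] with s hs1 hs2 hs3
    have hs3 : 0 < s := hs3
    have h4 : 0 < ε κ * (‖z + s * w - c κ‖ - r κ) := by
      by_contra hle
      refine hs1 ((hD.mem_iff _).mpr fun κ' => ?_)
      by_cases hne : κ' = κ
      · rw [hne]; exact not_lt.mp hle
      · exact (hs2 κ' hne).le
    have h5 : ‖z + s * w - c κ‖ ^ 2 - r κ ^ 2 =
        s * (2 * (starRingEnd ℂ w * (z - c κ)).re + s * ‖w‖ ^ 2) := by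
      rw [← h, ← Complex.normSq_eq_norm_sq, ← Complex.normSq_eq_norm_sq,
        ← Complex.normSq_eq_norm_sq]
      simp [Complex.normSq_apply]
      ring
    have h6 : 0 < ‖z + s * w - c κ‖ + r κ := by
      have := hD.radius_pos κ
      positivity
    have h7 : 0 < s * (ε κ * (2 * (starRingEnd ℂ w * (z - c κ)).re + s * ‖w‖ ^ 2)) := by
      have : s * (ε κ * (2 * (starRingEnd ℂ w * (z - c κ)).re + s * ‖w‖ ^ 2)) =
          (ε κ * (‖z + s * w - c κ‖ - r κ)) * (‖z + s * w - c κ‖ + r κ) := by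
        linear_combination (-(ε κ : ℝ)) * h5
      rw [this]
      positivity
    exact (pos_of_mul_pos_right h7 hs3.le).le
  have hc : Continuous fun s : ℝ =>
      (ε κ : ℝ) * (2 * (starRingEnd ℂ w * (z - c κ)).re + s * ‖w‖ ^ 2) := by fun_prop
  have hlim := ge_of_tendsto ((hc.tendsto 0).mono_left nhdsWithin_le_nhds) hpos
  simp only [zero_mul, add_zero] at hlim
  linarith

end IsCircleDomain

open scoped Asymptotics

/-! ### Embeddings of surfaces into the plane near the boundary -/

section Embedding

variable {M : Type*} [TopologicalSpace M] [ChartedSpace (EuclideanHalfSpace 2) M]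
  {Φ : M → ℂ}

/-- The derivative of a plane-valued map on a surface, as a linear map into `ℂ`. -/
noncomputable def differential (Φ : M → ℂ) (x : M) : TangentSpace (𝓡∂ 2) x →L[ℝ] ℂ :=
  mfderiv (𝓡∂ 2) 𝓘(ℝ, ℂ) Φ x

/-- The derivative of a plane-valued map on a surface, as a linear map on the model space of the
chart at the point. -/
noncomputable def chartDifferential (Φ : M → ℂ) (x : M) : Plane →L[ℝ] ℂ :=
  fderivWithin ℝ (Φ ∘ (extChartAt (𝓡∂ 2) x).symm) (Set.range (𝓡∂ 2)) (extChartAt (𝓡∂ 2) x x)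

theorem differential_eq_chartDifferential (hΦ : ContMDiff (𝓡∂ 2) 𝓘(ℝ, ℂ) ∞ Φ) (x : M)
    (v : TangentSpace (𝓡∂ 2) x) : differential Φ x v = chartDifferential Φ x v := by
  have h := ((hΦ x).mdifferentiableAt (by simp)).mfderiv
  exact congrArg (fun L : Plane →L[ℝ] ℂ => L v) h

theorem hasFDerivWithinAt_chart (hΦ : ContMDiff (𝓡∂ 2) 𝓘(ℝ, ℂ) ∞ Φ) (x : M) :
    HasFDerivWithinAt (Φ ∘ (extChartAt (𝓡∂ 2) x).symm) (chartDifferential Φ x)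
      (Set.range (𝓡∂ 2)) (extChartAt (𝓡∂ 2) x x) :=
  ((contMDiffAt_iff.mp (hΦ x)).2.differentiableWithinAt (by simp)).hasFDerivWithinAt

/-- By the inverse function theorem, an immersion is open at interior points. -/
theorem range_mem_nhds_of_isInteriorPoint (hΦ : ContMDiff (𝓡∂ 2) 𝓘(ℝ, ℂ) ∞ Φ) {x : M}
    (hsurj : Function.Surjective (differential Φ x))
    (hx : (𝓡∂ 2).IsInteriorPoint x) : Set.range Φ ∈ 𝓝 (Φ x) := by
  have hr := range_mem_nhds_isInteriorPoint hx
  have h1 := (contMDiffAt_iff.mp (hΦ x)).2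
  simp only [extChartAt_model_space_eq_id, PartialEquiv.refl_coe, Function.id_comp] at h1
  have h2 := h1.contDiffAt hr
  have h3 := h2.hasStrictFDerivAt (by simp)
  have hf : fderiv ℝ (Φ ∘ (extChartAt (𝓡∂ 2) x).symm) (extChartAt (𝓡∂ 2) x x) =
      chartDifferential Φ x := ((hasFDerivWithinAt_chart hΦ x).hasFDerivAt hr).fderiv
  rw [hf] at h3
  have h4 := h3.map_nhds_eq_of_surj (LinearMap.range_eq_top.mpr fun w => by
    obtain ⟨v, hv⟩ := hsurj w
    exact ⟨v, (differential_eq_chartDifferential hΦ x v).symm.trans hv⟩)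
  have h5 : (Φ ∘ (extChartAt (𝓡∂ 2) x).symm) (extChartAt (𝓡∂ 2) x x) = Φ x :=
    congrArg Φ (extChartAt_to_inv x)
  rw [h5] at h4
  rw [← h4]
  exact Filter.mem_map.mpr (Filter.univ_mem' fun y => ⟨_, rfl⟩)

/-- The tangent space at `x` is the model space of the chart at `x`, so there the derivative of this
chart is the identity. -/
theorem isOutward_iff [IsManifold (𝓡∂ 2) ∞ M] (x : M) (v : TangentSpace (𝓡∂ 2) x) :
    IsOutward x v ↔ (show Plane from v) 0 < 0 := by
  have h1 := (mdifferentiableAt_extChartAt (I := 𝓡∂ 2)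
    (ChartedSpace.mem_chart_source (H := EuclideanHalfSpace 2) x)).mfderiv
  have h2 : HasFDerivWithinAt (extChartAt (𝓡∂ 2) x ∘ (extChartAt (𝓡∂ 2) x).symm)
      (ContinuousLinearMap.id ℝ Plane) (Set.range (𝓡∂ 2)) (extChartAt (𝓡∂ 2) x x) := by
    refine (hasFDerivWithinAt_id _ _).congr_of_eventuallyEq ?_ ?_
    · filter_upwards [extChartAt_target_mem_nhdsWithin (I := 𝓡∂ 2) x] with y hy
      exact (extChartAt (𝓡∂ 2) x).right_inv hy
    · exact congrArg _ (extChartAt_to_inv x)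
  have h3 := h2.fderivWithin ((𝓡∂ 2).uniqueDiffOn _ ⟨_, rfl⟩)
  exact Eq.to_iff (congrArg (fun L : Plane →L[ℝ] Plane => L v 0 < 0) (h1.trans h3))

theorem exists_isOutward [IsManifold (𝓡∂ 2) ∞ M] (x : M) :
    ∃ v : TangentSpace (𝓡∂ 2) x, IsOutward x v :=
  ⟨(!₂[-1, 0] : Plane), (isOutward_iff x _).mpr (by
    show (!₂[-1, 0] : Plane) 0 < 0
    simp)⟩

/-- Along the image of an outward vector at a boundary point one leaves the image of the surface. -/
theorem IsOutward.eventually_notMem_range [IsManifold (𝓡∂ 2) ∞ M]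
    (hΦ : ContMDiff (𝓡∂ 2) 𝓘(ℝ, ℂ) ∞ Φ)
    (hind : Topology.IsInducing Φ) {x : M}
    (hinj : Function.Injective (differential Φ x))
    (hx : (𝓡∂ 2).IsBoundaryPoint x) {v : TangentSpace (𝓡∂ 2) x} (hv : IsOutward x v) :
    ∀ᶠ s : ℝ in 𝓝[>] 0, Φ x + s * differential Φ x v ∉ Set.range Φ := by
  rw [differential_eq_chartDifferential hΦ]
  set L : Plane →L[ℝ] ℂ := chartDifferential Φ x with hL
  have hv0 : (show Plane from v) 0 < 0 := (isOutward_iff x v).mp hv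
  set v : Plane := v with hvdef
  -- Otherwise `Φ x + s L v = Φ (y s)` for arbitrarily small `s > 0`, with `y s → x`.
  by_contra hcon
  have hfreq : ∃ᶠ s : ℝ in 𝓝[>] 0, Φ x + (s : ℂ) * L v ∈ Set.range Φ := by
    rw [Filter.Frequently]
    exact hcon
  let l : Filter ℝ := 𝓝[>] 0 ⊓ Filter.principal {s : ℝ | Φ x + s * L v ∈ Set.range Φ}
  have : l.NeBot := Filter.frequently_mem_iff_neBot.mp hfreq
  have hl0 : l ≤ 𝓝 0 := inf_le_left.trans nhdsWithin_le_nhds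
  have hlmem : ∀ᶠ s : ℝ in l, Φ x + (s : ℂ) * L v ∈ Set.range Φ :=
    Filter.mem_inf_of_right (Filter.mem_principal_self _)
  have hlpos : ∀ᶠ s : ℝ in l, 0 < s := Filter.mem_inf_of_left self_mem_nhdsWithin
  have : Nonempty M := ⟨x⟩
  let y : ℝ → M := fun s => Function.invFun Φ (Φ x + s * L v)
  have hy : ∀ᶠ s : ℝ in l, Φ (y s) = Φ x + (s : ℂ) * L v := by
    filter_upwards [hlmem] with s hs using Function.invFun_eq hs
  have hyx : Filter.Tendsto y l (𝓝 x) := by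
    rw [hind.tendsto_nhds_iff]
    have hc : Continuous fun s : ℝ => Φ x + s * L v := by fun_prop
    have h1 : Filter.Tendsto (fun s : ℝ => Φ x + s * L v) l (𝓝 (Φ x)) := by
      simpa using (hc.tendsto 0).mono_left hl0
    exact h1.congr' (hy.mono fun s hs => hs.symm)
  set p := extChartAt (𝓡∂ 2) x x with hp
  let q : ℝ → Plane := fun s => extChartAt (𝓡∂ 2) x (y s)
  have hq : Filter.Tendsto q l (𝓝 p) := (continuousAt_extChartAt x).tendsto.comp hyx
  have hqr : ∀ s, q s ∈ Set.range (𝓡∂ 2) := fun s => ⟨_, rfl⟩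
  have hsrc : ∀ᶠ s : ℝ in l, y s ∈ (extChartAt (𝓡∂ 2) x).source :=
    hyx.eventually (extChartAt_source_mem_nhds x)
  have hd := (hasFDerivWithinAt_chart hΦ x).isLittleO.comp_tendsto
    (tendsto_nhdsWithin_iff.mpr ⟨hq, Filter.Eventually.of_forall hqr⟩)
  have hd2 : (fun s : ℝ => L (s • v - (q s - p))) =o[l] fun s => q s - p := by
    refine hd.congr' ?_ (Filter.Eventually.of_forall fun s => rfl)
    filter_upwards [hy, hsrc] with s hs1 hs2
    have e1 : (extChartAt (𝓡∂ 2) x).symm (q s) = y s := (extChartAt (𝓡∂ 2) x).left_inv hs2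
    have e2 : (extChartAt (𝓡∂ 2) x).symm p = x := extChartAt_to_inv x
    simp only [Function.comp_apply, e1, ← hp, e2, hs1, ← hL, map_sub, map_smul, Complex.real_smul]
    ring
  obtain ⟨K, -, hK⟩ := (L : Plane →ₗ[ℝ] ℂ).exists_antilipschitzWith (LinearMap.ker_eq_bot.mpr
    fun a b hab => hinj (((differential_eq_chartDifferential hΦ x a).trans hab).trans
      (differential_eq_chartDifferential hΦ x b).symm))
  have hd3 : (fun s : ℝ => s • v - (q s - p)) =o[l] fun s => q s - p :=
    (Asymptotics.IsBigO.of_bound K (Filter.Eventually.of_forall fun s =>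
      L.bound_of_antilipschitz hK _)).trans_isLittleO hd2
  have hequiv : Asymptotics.IsEquivalent l (fun s => q s - p) fun s : ℝ => s • v :=
    Asymptotics.IsEquivalent.symm hd3
  -- The chart coordinates `q s` are `p + s v + o(s)`, so they leave the half plane for small `s`.
  have hsmall := hequiv.isLittleO
  have hC : 0 < -v 0 / (2 * (‖v‖ + 1)) := div_pos (by linarith) (by positivity)
  obtain ⟨s, hs, hspos⟩ := ((hsmall.def hC).and hlpos).exists
  have hp0 : p 0 = 0 := by
    have : p ∈ frontier (Set.range (𝓡∂ 2)) := hx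
    rw [frontier_range_modelWithCornersEuclideanHalfSpace] at this
    exact this.symm
  have hq0 : 0 ≤ q s 0 := by
    have := hqr s
    rw [range_modelWithCornersEuclideanHalfSpace] at this
    exact this
  have hcoord : q s 0 - s * v 0 ≤ ‖(q s - p) - s • v‖ := by
    have := PiLp.norm_apply_le ((q s - p) - s • v) 0
    simp only [PiLp.sub_apply, PiLp.smul_apply, smul_eq_mul, hp0, sub_zero] at this
    exact (le_abs_self _).trans this
  have h9 : ‖(q s - p) - s • v‖ ≤ -v 0 / (2 * (‖v‖ + 1)) * (s * ‖v‖) := by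
    have := hs
    rw [norm_smul, Real.norm_of_nonneg hspos.le] at this
    exact this
  have h10 : -v 0 / (2 * (‖v‖ + 1)) * (s * ‖v‖) ≤ s * (-v 0) / 2 := by
    rw [div_mul_eq_mul_div, div_le_div_iff₀ (by positivity) (by norm_num)]
    have := mul_pos hspos (neg_pos.mpr hv0)
    nlinarith [norm_nonneg v]
  nlinarith [mul_pos hspos (neg_pos.mpr hv0)]

end Embedding

/-! ### The boundary loops of a planar surface -/

section PlanarSurface

variable {M : Type*} [TopologicalSpace M] [ChartedSpace (EuclideanHalfSpace 2) M]
  [IsManifold (𝓡∂ 2) ∞ M] {ι : Type*}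

theorem continuous_differential {Φ : M → ℂ}
    (hΦ : ContMDiff (𝓡∂ 2) 𝓘(ℝ, ℂ) ∞ Φ) :
    Continuous fun p : TangentBundle (𝓡∂ 2) M => differential Φ p.1 p.2 := by
  have h1 := hΦ.continuous_tangentMap (by simp)
  have h2 := (tangentBundleModelSpaceHomeomorph 𝓘(ℝ, ℂ)).continuous.comp h1
  exact continuous_snd.comp h2

/-- `Φ` is an orientation-preserving smooth embedding of the surface `(M, o)` into the plane whose
image is the domain bounded by the circles with centres `c κ` and radii `r κ`. -/
structure IsPlanarEmbedding (o : SurfaceOrientation M) (c : ι → ℂ) (r : ι → ℝ) (ε : ι → ℤ)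
    (Φ : M → ℂ) : Prop where
  smooth : ContMDiff (𝓡∂ 2) 𝓘(ℝ, ℂ) ∞ Φ
  injective : Function.Injective Φ
  bijective : ∀ x, Function.Bijective (differential Φ x)
  circleDomain : IsCircleDomain c r ε (Set.range Φ)
  oriented : ∀ x v w, IsPositiveBasis (o.orient x) v w →
    0 < (starRingEnd ℂ (differential Φ x v) * differential Φ x w).im

theorem ImmersedLoop.hasDerivAt_comp {Φ : M → ℂ} (hΦ : ContMDiff (𝓡∂ 2) 𝓘(ℝ, ℂ) ∞ Φ)
    (γ : ImmersedLoop M) (t : ℝ) :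
    HasDerivAt (fun t => Φ (γ.toFun t)) (differential Φ (γ.toFun t) (γ.velocity t)) t := by
  have h1 := ((hΦ (γ.toFun t)).mdifferentiableAt (by simp)).hasMFDerivAt
  have h2 := ((γ.smooth t).mdifferentiableAt (by simp)).hasMFDerivAt
  let L : ℝ →L[ℝ] ℂ := (mfderiv (𝓡∂ 2) 𝓘(ℝ, ℂ) Φ (γ.toFun t)).comp
    (mfderiv 𝓘(ℝ, ℝ) (𝓡∂ 2) γ.toFun t)
  have h3 : HasFDerivAt (fun t => Φ (γ.toFun t)) L t := (h1.comp t h2).hasFDerivAt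
  exact h3.hasDerivAt

/-- The loop `γ` runs once around the circle `κ`, in the direction `ε κ`. -/
structure RunsAround (Φ : M → ℂ) (c : ι → ℂ) (r : ι → ℝ) (ε : ι → ℤ) (γ : ImmersedLoop M)
    (κ : ι) : Prop where
  exists_angle : ∃ θ : ℝ → ℝ, Continuous θ ∧ (∀ t, θ (t + 1) = θ t + ε κ) ∧
    ∀ t, Φ (γ.toFun t) = circlePoint (c κ) (r κ) (θ t)
  surjective : ∀ s, ∃ t, circlePoint (c κ) (r κ) s = Φ (γ.toFun t)
  winds_velocity : Winds (fun t => differential Φ (γ.toFun t) (γ.velocity t)) (ε κ)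

namespace IsPlanarEmbedding

variable {o : SurfaceOrientation M} {c : ι → ℂ} {r : ι → ℝ} {ε : ι → ℤ} {Φ : M → ℂ}

theorem isClosedEmbedding [CompactSpace M] (h : IsPlanarEmbedding o c r ε Φ) :
    Topology.IsClosedEmbedding Φ :=
  h.smooth.continuous.isClosedEmbedding h.injective

theorem exists_mem_circle_of_isBoundaryPoint [CompactSpace M] [Finite ι]
    (h : IsPlanarEmbedding o c r ε Φ) {x : M} (hx : (𝓡∂ 2).IsBoundaryPoint x) :
    ∃ κ, ‖Φ x - c κ‖ = r κ := by
  by_contra! hne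
  have hn := h.circleDomain.mem_nhds_of_forall_ne ⟨x, rfl⟩ hne
  obtain ⟨v, hv⟩ := exists_isOutward x
  have h1 := hv.eventually_notMem_range h.smooth h.isClosedEmbedding.isInducing
    (h.bijective x).1 hx
  have hc : Continuous fun s : ℝ => Φ x + s * differential Φ x v := by fun_prop
  have h2 : ∀ᶠ s : ℝ in 𝓝 0, Φ x + s * differential Φ x v ∈ Set.range Φ :=
    hc.continuousAt.preimage_mem_nhds (by simpa using hn)
  obtain ⟨s, hs1, hs2⟩ := (h1.and (h2.filter_mono nhdsWithin_le_nhds)).exists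
  exact hs1 hs2

theorem isBoundaryPoint_of_mem_circle (h : IsPlanarEmbedding o c r ε Φ) {x : M} {κ : ι}
    (hκ : ‖Φ x - c κ‖ = r κ) : (𝓡∂ 2).IsBoundaryPoint x := by
  rw [ModelWithCorners.isBoundaryPoint_iff_not_isInteriorPoint]
  intro hx
  exact h.circleDomain.not_mem_nhds_of_mem_circle hκ
    (range_mem_nhds_of_isInteriorPoint h.smooth (h.bijective x).2 hx)

/-- The boundary orientation: along an oriented boundary loop on the circle `κ`, the angle moves in
the direction given by the sign `ε κ`. -/
theorem angular_velocity_pos [CompactSpace M] [Finite ι] (h : IsPlanarEmbedding o c r ε Φ) {n : ℕ}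
    (B : BoundaryNumbering o n) (j : Fin (n + 1)) {κ : ι}
    (hκ : ∀ t, ‖Φ ((B.loop j).toFun t) - c κ‖ = r κ) (t : ℝ) :
    ∃ μ : ℝ, 0 < ε κ * μ ∧
      differential Φ ((B.loop j).toFun t) ((B.loop j).velocity t) =
        μ * Complex.I * (Φ ((B.loop j).toFun t) - c κ) := by
  set x := (B.loop j).toFun t with hx
  obtain ⟨v, hv⟩ := exists_isOutward x
  have hb := h.isBoundaryPoint_of_mem_circle (hκ t)
  have h1 := h.circleDomain.nonneg_of_eventually_notMem (hκ t)
    (hv.eventually_notMem_range h.smooth h.isClosedEmbedding.isInducing (h.bijective x).1 hb)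
  have h2 := h.oriented x v _ (B.oriented j t v hv)
  have hd := (B.loop j).hasDerivAt_comp h.smooth t
  rw [← hx] at hd
  set w := differential Φ x v with hw
  set z' := differential Φ x ((B.loop j).velocity t) with hz'
  have hne : Φ x - c κ ≠ 0 := norm_ne_zero_iff.mp (by
    rw [hκ t]
    exact (h.circleDomain.radius_pos κ).ne')
  -- The velocity is orthogonal to the radius.
  have horth : (starRingEnd ℂ (Φ x - c κ) * z').re = 0 := by
    have h3 := ((hd.sub_const (c κ)).norm_sq)
    have h4 : (fun t => ‖Φ ((B.loop j).toFun t) - c κ‖ ^ 2) = fun _ => r κ ^ 2 := by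
      funext s
      rw [hκ s]
    rw [h4] at h3
    have h5 := h3.unique (hasDerivAt_const t (r κ ^ 2))
    rw [Complex.inner] at h5
    simp only [← hx] at h5
    rw [mul_comm] at h5
    simpa [mul_comm] using h5
  set ζ := Φ x - c κ with hζ
  have hz : z' = ((z' / ζ).im : ℝ) * Complex.I * ζ := by
    have hre : (z' / ζ).re = 0 := by
      rw [Complex.div_re]
      have : z'.re * ζ.re + z'.im * ζ.im = 0 := by
        simp at horth
        linarith
      rw [← add_div, this, zero_div]
    have : ((z' / ζ).im : ℂ) * Complex.I = z' / ζ := by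
      conv_rhs => rw [← Complex.re_add_im (z' / ζ), hre]
      simp
    rw [this, div_mul_cancel₀ _ hne]
  refine ⟨(z' / ζ).im, ?_, hz⟩
  generalize (z' / ζ).im = μ at hz
  rw [hz] at h2
  have h6 : (starRingEnd ℂ w * (μ * Complex.I * ζ)).im = μ * (starRingEnd ℂ w * ζ).re := by
    simp
    ring
  rw [h6] at h2
  rcases h.circleDomain.sign κ with hs | hs <;> rw [hs] at h1 ⊢ <;> push_cast at h1 ⊢ <;>
    nlinarith

/-- As a boundary loop is connected, it stays on one of the disjoint boundary circles. -/
theorem exists_circle_of_loop [CompactSpace M] [Finite ι] (h : IsPlanarEmbedding o c r ε Φ) {n : ℕ}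
    (B : BoundaryNumbering o n) (j : Fin (n + 1)) :
    ∃ κ, ∀ t, ‖Φ ((B.loop j).toFun t) - c κ‖ = r κ := by
  have hc : Continuous fun t => Φ ((B.loop j).toFun t) :=
    h.smooth.continuous.comp (B.loop j).smooth.continuous
  have hex : ∀ t, ∃ κ, ‖Φ ((B.loop j).toFun t) - c κ‖ = r κ := fun t =>
    h.exists_mem_circle_of_isBoundaryPoint (by
      have : (B.loop j).toFun t ∈ (𝓡∂ 2).boundary M := by
        rw [← B.iUnion_range]
        exact Set.mem_iUnion.mpr ⟨j, t, rfl⟩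
      exact this)
  let S : ι → Set ℝ := fun κ => {t | ‖Φ ((B.loop j).toFun t) - c κ‖ = r κ}
  have hS : ∀ κ, IsClosed (S κ) := fun κ =>
    isClosed_eq (hc.sub continuous_const).norm continuous_const
  obtain ⟨κ, hκ⟩ := hex 0
  have hcompl : (S κ)ᶜ = ⋃ κ' : {κ' // κ' ≠ κ}, S κ' := by
    ext t
    simp only [Set.mem_compl_iff, Set.mem_iUnion]
    constructor
    · intro ht
      obtain ⟨κ', hκ'⟩ := hex t
      exact ⟨⟨κ', fun he => ht (he ▸ hκ')⟩, hκ'⟩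
    · rintro ⟨⟨κ', hne⟩, ht⟩ ht'
      exact hne (h.circleDomain.eq_of_mem_circles ht ht')
  have hopen : IsOpen (S κ) := by
    rw [← isClosed_compl_iff, hcompl]
    exact isClosed_iUnion_of_finite fun κ' => hS κ'
  have huniv := IsClopen.eq_univ ⟨hS κ, hopen⟩ ⟨0, hκ⟩
  exact ⟨κ, fun t => by
    have : t ∈ S κ := huniv ▸ Set.mem_univ t
    exact this⟩

theorem exists_runsAround [CompactSpace M] [Finite ι] (h : IsPlanarEmbedding o c r ε Φ) {n : ℕ}
    (B : BoundaryNumbering o n) (j : Fin (n + 1)) : ∃ κ, RunsAround Φ c r ε (B.loop j) κ := by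
  obtain ⟨κ, hκ⟩ := h.exists_circle_of_loop B j
  refine ⟨κ, ?_⟩
  have hr := h.circleDomain.radius_pos κ
  set γ := B.loop j with hγ
  have hper : ∀ t, Φ (γ.toFun (t + 1)) = Φ (γ.toFun t) := fun t => by rw [γ.periodic]
  have hd := γ.hasDerivAt_comp h.smooth
  choose μ hμ hz' using h.angular_velocity_pos B j hκ
  rw [← hγ] at hz'
  have hne : ∀ t, Φ (γ.toFun t) - c κ ≠ 0 := fun t =>
    norm_ne_zero_iff.mp (by rw [hκ]; exact hr.ne')
  have hμd : ∀ t, differential Φ (γ.toFun t) (γ.velocity t) / (Φ (γ.toFun t) - c κ) =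
      μ t * Complex.I := fun t => by rw [hz', mul_div_cancel_right₀ _ (hne t)]
  obtain ⟨θ, hθ, hθp, hzθ, hsurj⟩ := exists_angle_of_simple (h.circleDomain.sign κ) hr hd hper hκ
    (fun t => by rw [hμd]; simpa using hμ t)
    (fun s t hst => B.simple j s t (h.injective hst))
  refine ⟨⟨θ, hθ, hθp, hzθ⟩, hsurj, ?_⟩
  have hw := winds_circlePoint_sub (c κ) hr hθ hθp
  simp only [← hzθ] at hw
  have hcz : Continuous fun t => Φ (γ.toFun t) :=
    h.smooth.continuous.comp γ.smooth.continuous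
  have hcz' : Continuous fun t => differential Φ (γ.toFun t) (γ.velocity t) :=
    (continuous_differential h.smooth).comp γ.continuous_velocity
  have hμim : μ = fun t =>
      (differential Φ (γ.toFun t) (γ.velocity t) / (Φ (γ.toFun t) - c κ)).im := by
    funext t
    rw [hμd]
    simp
  have hμc : Continuous μ := by
    rw [hμim]
    exact Complex.continuous_im.comp (hcz'.div (hcz.sub continuous_const) hne)
  have hz'p : ∀ t, differential Φ (γ.toFun (t + 1)) (γ.velocity (t + 1)) =
      differential Φ (γ.toFun t) (γ.velocity t) := fun t => by
    have h1 := (hd (t + 1)).comp_add_const t 1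
    simp only [hper] at h1
    exact h1.unique (hd t)
  have hμp : ∀ t, μ (t + 1) = μ t := fun t => by
    rw [hμim]
    simp only [hz'p, hper]
  have hε : (ε κ : ℝ) * ε κ = 1 := by
    rcases h.circleDomain.sign κ with hs | hs <;> simp [hs]
  have hε0 : (ε κ : ℂ) * Complex.I ≠ 0 := by
    rcases h.circleDomain.sign κ with hs | hs <;> simp [hs]
  have h0 := winds_exp_periodic
    (h := fun t => (Real.log (ε κ * μ t) : ℂ) + Complex.log (ε κ * Complex.I))
    (by
      have : Continuous fun t => Real.log (ε κ * μ t) :=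
        (continuous_const.mul hμc).log fun t => (hμ t).ne'
      fun_prop)
    (fun t => by rw [hμp])
  have h1 := hw.mul h0
  rw [add_zero] at h1
  convert h1 using 2 with t
  rw [Complex.exp_add, ← Complex.ofReal_exp, Real.exp_log (hμ t), Complex.exp_log hε0, hz']
  have hεC : (ε κ : ℂ) * ε κ = 1 := by exact_mod_cast hε
  push_cast
  linear_combination (-(μ t : ℂ) * Complex.I * (Φ (γ.toFun t) - c κ)) * hεC

/-- The boundary loops correspond bijectively to the boundary circles. -/
theorem exists_equiv_runsAround [CompactSpace M] [Finite ι] (h : IsPlanarEmbedding o c r ε Φ)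
    {n : ℕ} (B : BoundaryNumbering o n) :
    ∃ σ : Fin (n + 1) ≃ ι, ∀ j, RunsAround Φ c r ε (B.loop j) (σ j) := by
  choose κ hκ using h.exists_runsAround B
  have hon : ∀ j t, ‖Φ ((B.loop j).toFun t) - c (κ j)‖ = r (κ j) := fun j t => by
    obtain ⟨θ, -, -, hθ⟩ := (hκ j).exists_angle
    rw [hθ, norm_circlePoint_sub _ (h.circleDomain.radius_pos _).le]
  refine ⟨Equiv.ofBijective κ ⟨fun j k hjk => ?_, fun l => ?_⟩, hκ⟩
  · by_contra hne
    obtain ⟨t, ht⟩ := (hκ j).surjective 0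
    obtain ⟨s, hs⟩ := (hκ k).surjective 0
    rw [hjk, hs] at ht
    exact Set.disjoint_left.mp (B.disjoint j k hne) ⟨t, (h.injective ht).symm⟩ ⟨s, rfl⟩
  · have h1 := norm_circlePoint_sub (c l) (h.circleDomain.radius_pos l).le 0
    obtain ⟨x, hx⟩ := h.circleDomain.mem_of_mem_circle h1
    rw [← hx] at h1
    have h2 : x ∈ (𝓡∂ 2).boundary M := h.isBoundaryPoint_of_mem_circle h1
    rw [← B.iUnion_range] at h2
    obtain ⟨j, t, rfl⟩ := Set.mem_iUnion.mp h2
    exact ⟨j, h.circleDomain.eq_of_mem_circles (hon j t) h1⟩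

end IsPlanarEmbedding

end PlanarSurface

/-! ### Windings of functions along the boundary loops -/

/-- The discs with centres `c i` and radii `r i` have disjoint closures in the open unit disc. -/
structure AreHoles {m : ℕ} (c : Fin m → ℂ) (r : Fin m → ℝ) : Prop where
  radius_pos : ∀ i, 0 < r i
  subset : ∀ i, Metric.closedBall (c i) (r i) ⊆ Metric.ball 0 1
  disjoint : ∀ i j, i ≠ j → Disjoint (Metric.closedBall (c i) (r i)) (Metric.closedBall (c j) (r j))

/-- Centres of the boundary circles of the unit disc with holes: the outer circle is numbered
`none`, and the boundary of hole `i` is numbered `some i`. -/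
def circleCenter {m : ℕ} (c : Fin m → ℂ) (κ : Option (Fin m)) : ℂ := κ.elim 0 c

/-- Radii of the boundary circles of the unit disc with holes. -/
def circleRadius {m : ℕ} (r : Fin m → ℝ) (κ : Option (Fin m)) : ℝ := κ.elim 1 r

/-- The sense in which the boundary circles of the unit disc with holes are run through:
counterclockwise on the outer circle, clockwise around the holes. -/
def circleSign (m : ℕ) (κ : Option (Fin m)) : ℤ := κ.elim 1 (fun _ => -1)

section Holes

variable {m : ℕ} {c : Fin m → ℂ} {r : Fin m → ℝ}

theorem AreHoles.isCircleDomain (h : AreHoles c r) :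
    IsCircleDomain (circleCenter c) (circleRadius r) (circleSign m)
      (Metric.closedBall 0 1 \ ⋃ i, Metric.ball (c i) (r i)) := by
  refine ⟨?_, ?_, fun z => ?_, ?_⟩
  · rintro (_ | i)
    exacts [one_pos, h.radius_pos i]
  · rintro (_ | i)
    exacts [Or.inl rfl, Or.inr rfl]
  · simp [Option.forall, circleCenter, circleRadius, circleSign, dist_eq_norm]
  · rintro (_ | i) (_ | j) hne z hz
    · exact absurd rfl hne
    · have h1 : ‖z‖ = 1 := by simpa [circleCenter, circleRadius] using hz
      have h2 : z ∉ Metric.closedBall (c j) (r j) := fun hj => by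
        have := h.subset j hj
        rw [mem_ball_zero_iff, h1] at this
        exact this.false
      rw [mem_closedBall_iff_norm, not_le] at h2
      simpa [circleCenter, circleRadius, circleSign] using h2
    · have h1 : z ∈ Metric.closedBall (c i) (r i) := mem_closedBall_iff_norm.mpr (le_of_eq hz)
      have h2 := h.subset i h1
      rw [mem_ball_zero_iff] at h2
      simpa [circleCenter, circleRadius, circleSign] using h2
    · have h1 : z ∈ Metric.closedBall (c i) (r i) := mem_closedBall_iff_norm.mpr (le_of_eq hz)
      have h2 := Set.disjoint_left.mp (h.disjoint i j fun hij => hne (congrArg some hij)) h1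
      rw [mem_closedBall_iff_norm, not_le] at h2
      simpa [circleCenter, circleRadius, circleSign] using h2

variable {M : Type*} [TopologicalSpace M] [ChartedSpace (EuclideanHalfSpace 2) M]
  [IsManifold (𝓡∂ 2) ∞ M]

/-- `Φ` is an orientation-preserving smooth embedding of the surface `(M, o)` into the plane whose
image is the unit disc with the holes of centres `c i` and radii `r i`. -/
structure IsHoledDiscEmbedding (o : SurfaceOrientation M) (c : Fin m → ℂ) (r : Fin m → ℝ)
    (Φ : M → ℂ) : Prop where
  areHoles : AreHoles c r
  smooth : ContMDiff (𝓡∂ 2) 𝓘(ℝ, ℂ) ∞ Φ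
  injective : Function.Injective Φ
  bijective : ∀ x, Function.Bijective (differential Φ x)
  range_eq : Set.range Φ = Metric.closedBall 0 1 \ ⋃ i, Metric.ball (c i) (r i)
  oriented : ∀ x v w, IsPositiveBasis (o.orient x) v w →
    0 < (starRingEnd ℂ (differential Φ x v) * differential Φ x w).im

namespace IsHoledDiscEmbedding

variable {o : SurfaceOrientation M} {Φ : M → ℂ}

theorem isPlanarEmbedding (h : IsHoledDiscEmbedding o c r Φ) :
    IsPlanarEmbedding o (circleCenter c) (circleRadius r) (circleSign m) Φ :=
  ⟨h.smooth, h.injective, h.bijective, h.range_eq ▸ h.areHoles.isCircleDomain, h.oriented⟩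

theorem ne_center (h : IsHoledDiscEmbedding o c r Φ) (x : M) (i : Fin m) : Φ x - c i ≠ 0 := by
  intro h0
  have hx : Φ x ∈ Set.range Φ := ⟨x, rfl⟩
  rw [h.range_eq] at hx
  refine hx.2 (Set.mem_iUnion.mpr ⟨i, ?_⟩)
  rw [sub_eq_zero.mp h0]
  exact Metric.mem_ball_self (h.areHoles.radius_pos i)

variable {n : ℕ} {B : BoundaryNumbering o n}
  {σ : Fin (n + 1) ≃ Option (Fin m)}

/-- A nowhere vanishing function that does not wind around any hole has a continuous logarithm. -/
theorem exists_log [CompactSpace M] (h : IsHoledDiscEmbedding o c r Φ)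
    (hσ : ∀ j, RunsAround Φ (circleCenter c) (circleRadius r) (circleSign m) (B.loop j) (σ j))
    {a : M → ℂ} (ha : Continuous a) (h0 : ∀ x, a x ≠ 0)
    (hw : ∀ i, Winds (fun t => a ((B.loop (σ.symm (some i))).toFun t)) 0) :
    ∃ g : M → ℂ, Continuous g ∧ ∀ x, Complex.exp (g x) = a x := by
  obtain ⟨b, hb⟩ := ContinuousMap.exists_extension' h.isPlanarEmbedding.isClosedEmbedding
    (⟨a, ha⟩ : C(M, ℂ))
  have hb : ∀ x, b (Φ x) = a x := fun x => congrFun hb x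
  obtain ⟨g, hg, he⟩ := exists_log_on_disc_with_holes h.areHoles.radius_pos h.areHoles.disjoint
    b.continuous (by
      rw [← h.range_eq]
      rintro _ ⟨x, rfl⟩
      rw [hb]
      exact h0 x) (fun i => by
      have hrun := hσ (σ.symm (some i))
      rw [Equiv.apply_symm_apply] at hrun
      have hne : ∀ s, b (circlePoint (c i) (r i) s) ≠ 0 := fun s => by
        obtain ⟨t, ht⟩ := hrun.surjective s
        have ht : circlePoint (c i) (r i) s = _ := ht
        rw [ht, hb]
        exact h0 _
      obtain ⟨k, hk⟩ := exists_winds (z := fun s => b (circlePoint (c i) (r i) s))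
        (b.continuous.comp (continuous_circlePoint _ _)) hne
        (fun s => by rw [circlePoint_add_one])
      obtain ⟨θ, hθ, hθp, hθz⟩ := hrun.exists_angle
      have h1 := hk.comp_degree hθ hθp
      have h2 : (fun t => b (circlePoint (c i) (r i) (θ t))) =
          fun t => a ((B.loop (σ.symm (some i))).toFun t) := by
        funext t
        rw [← hb, hθz]
        rfl
      rw [h2] at h1
      have h3 := h1.unique (hw i)
      have h4 : k = 0 := by
        simp [circleSign] at h3
        exact h3
      rw [← h4]
      exact hk)
  rw [← h.range_eq] at he
  exact ⟨fun x => g (Φ x), hg.comp h.smooth.continuous, fun x => by rw [he _ ⟨x, rfl⟩, hb]⟩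

theorem winds_sub_center (h : IsHoledDiscEmbedding o c r Φ) {γ : ImmersedLoop M}
    {κ : Option (Fin m)}
    (hκ : RunsAround Φ (circleCenter c) (circleRadius r) (circleSign m) γ κ) (i : Fin m) :
    Winds (fun t => Φ (γ.toFun t) - c i) (κ.elim 1 fun l => if l = i then -1 else 0) := by
  obtain ⟨θ, hθ, hθp, hθz⟩ := hκ.exists_angle
  have hr := h.areHoles.isCircleDomain.radius_pos κ
  have hwind := winds_circlePoint_sub (circleCenter c κ) hr hθ hθp
  simp only [← hθz] at hwind
  have hc : Continuous fun t => Φ (γ.toFun t) := h.smooth.continuous.comp γ.smooth.continuous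
  have hp : ∀ t, Φ (γ.toFun (t + 1)) = Φ (γ.toFun t) := fun t => by rw [γ.periodic]
  have hn : ∀ t, ‖Φ (γ.toFun t) - circleCenter c κ‖ = circleRadius r κ := fun t => by
    rw [hθz, norm_circlePoint_sub _ hr.le]
  have hi := Metric.mem_closedBall_self (x := c i) (h.areHoles.radius_pos i).le
  rcases κ with _ | l
  · refine hwind.sub_of_mem_ball hp hn ?_
    simpa [circleCenter, circleRadius] using h.areHoles.subset i hi
  · by_cases hl : l = i
    · subst hl
      simpa [circleCenter, circleSign] using hwind
    · simp only [Option.elim, if_neg hl]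
      refine winds_sub_of_not_mem_closedBall hc hp hn ?_
      have := Set.disjoint_right.mp (h.areHoles.disjoint l i hl) hi
      rw [mem_closedBall_iff_norm, not_le] at this
      exact this

/-- The function `∏ (Φ - c i) ^ k i` winds `-k i` times along the clockwise boundary of hole `i`,
and `∑ k i` times along the outer boundary. -/
theorem winds_prod (h : IsHoledDiscEmbedding o c r Φ) {γ : ImmersedLoop M} {κ : Option (Fin m)}
    (hκ : RunsAround Φ (circleCenter c) (circleRadius r) (circleSign m) γ κ) (k : Fin m → ℤ) :
    Winds (fun t => ∏ i, (Φ (γ.toFun t) - c i) ^ k i) (κ.elim (∑ i, k i) fun i => -k i) := by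
  have h1 := Winds.prod Finset.univ fun i => (h.winds_sub_center hκ i).zpow (k i)
  convert h1 using 1
  rcases κ with _ | l <;> simp

theorem continuous_prod (h : IsHoledDiscEmbedding o c r Φ) (k : Fin m → ℤ) :
    Continuous fun x => ∏ i, (Φ x - c i) ^ k i :=
  continuous_finsetProd _ fun i _ =>
    (h.smooth.continuous.sub continuous_const).zpow₀ _ fun x => Or.inl (h.ne_center x i)

theorem prod_ne_zero (h : IsHoledDiscEmbedding o c r Φ) (k : Fin m → ℤ) (x : M) :
    ∏ i, (Φ x - c i) ^ k i ≠ 0 :=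
  Finset.prod_ne_zero_iff.mpr fun i _ => zpow_ne_zero _ (h.ne_center x i)

theorem sum_eq_none_add (k : Fin (n + 1) → ℤ) (σ : Fin (n + 1) ≃ Option (Fin m)) :
    ∑ j, k j = k (σ.symm none) + ∑ i, k (σ.symm (some i)) := by
  rw [← Equiv.sum_comp σ.symm, Fintype.sum_option]

/-- The windings of a nowhere vanishing function along all boundary loops add up to zero: after
multiplication by a product of powers of the functions `Φ - c i`, for which this is clear, it does
not wind around any hole, so it has a logarithm. -/
theorem sum_winding_eq_zero [CompactSpace M] (h : IsHoledDiscEmbedding o c r Φ)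
    (hσ : ∀ j, RunsAround Φ (circleCenter c) (circleRadius r) (circleSign m) (B.loop j) (σ j))
    {a : M → ℂ} (ha : Continuous a) (h0 : ∀ x, a x ≠ 0) {k : Fin (n + 1) → ℤ}
    (hw : ∀ j, Winds (fun t => a ((B.loop j).toFun t)) (k j)) : ∑ j, k j = 0 := by
  let e : Fin m → ℤ := fun i => k (σ.symm (some i))
  have hprod : ∀ j, Winds (fun t => a ((B.loop j).toFun t) *
      ∏ i, (Φ ((B.loop j).toFun t) - c i) ^ e i)
      (k j + (σ j).elim (∑ i, e i) fun i => -e i) :=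
    fun j => (hw j).mul (h.winds_prod (hσ j) e)
  obtain ⟨g, hg, he⟩ := h.exists_log hσ (ha.mul (h.continuous_prod e))
    (fun x => mul_ne_zero (h0 x) (h.prod_ne_zero e x)) (fun i => by
      have := hprod (σ.symm (some i))
      simpa [e] using this)
  have h1 : Winds (fun t => Complex.exp (g ((B.loop (σ.symm none)).toFun t)))
      (k (σ.symm none) + ∑ i, e i) := by
    simpa [he] using hprod (σ.symm none)
  have h2 := h1.unique (winds_exp_periodic
    (hg.comp (B.loop (σ.symm none)).smooth.continuous) fun t =>
      congrArg g ((B.loop (σ.symm none)).periodic t))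
  rw [sum_eq_none_add k σ]
  simpa [e] using h2

/-- Every family of integers with sum zero is the family of windings of a nowhere vanishing
function along the boundary loops. -/
theorem exists_winding_eq (h : IsHoledDiscEmbedding o c r Φ)
    (hσ : ∀ j, RunsAround Φ (circleCenter c) (circleRadius r) (circleSign m) (B.loop j) (σ j))
    {k : Fin (n + 1) → ℤ} (hk : ∑ j, k j = 0) :
    ∃ a : M → ℂ, Continuous a ∧ (∀ x, a x ≠ 0) ∧
      ∀ j, Winds (fun t => a ((B.loop j).toFun t)) (k j) := by
  let e : Fin m → ℤ := fun i => -k (σ.symm (some i))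
  refine ⟨_, h.continuous_prod e, h.prod_ne_zero e, fun j => ?_⟩
  have h1 := h.winds_prod (hσ j) e
  convert h1 using 1
  obtain ⟨κ, rfl⟩ := σ.symm.surjective j
  rw [sum_eq_none_add k σ] at hk
  rcases κ with _ | i
  · simp [e]
    linarith
  · simp [e]

end IsHoledDiscEmbedding

end Holes

/-! ### Orientations and signed areas -/

/-- The identification of the Euclidean plane with `ℂ`. -/
noncomputable def planeToComplex : Plane ≃L[ℝ] ℂ :=
  Complex.orthonormalBasisOneI.repr.symm.toContinuousLinearEquiv

theorem planeToComplex_apply (v : Plane) : planeToComplex v = ⟨v 0, v 1⟩ := by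
  show Complex.orthonormalBasisOneI.repr.symm v = _
  rw [LinearIsometryEquiv.symm_apply_eq]
  ext i
  fin_cases i <;> simp

theorem norm_planeToComplex (v : Plane) : ‖planeToComplex v‖ = ‖v‖ :=
  Complex.orthonormalBasisOneI.repr.symm.norm_map v

section Orientation

variable {V : Type*} [AddCommGroup V] [Module ℝ V]

theorem det_map_eq_area (e : V ≃ₗ[ℝ] Plane) (b : Module.Basis (Fin 2) ℝ V) :
    (EuclideanSpace.basisFun (Fin 2) ℝ).toBasis.det (b.map e) =
      (starRingEnd ℂ (planeToComplex (e (b 0))) * planeToComplex (e (b 1))).im := by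
  rw [Module.Basis.det_apply, Matrix.det_fin_two]
  simp [Module.Basis.toMatrix_apply, planeToComplex_apply]
  ring

theorem area_ne_zero (e : V ≃ₗ[ℝ] Plane) (b : Module.Basis (Fin 2) ℝ V) :
    (starRingEnd ℂ (planeToComplex (e (b 0))) * planeToComplex (e (b 1))).im ≠ 0 := by
  rw [← det_map_eq_area]
  exact ((EuclideanSpace.basisFun (Fin 2) ℝ).toBasis.isUnit_det (b.map e)).ne_zero

/-- A linear isomorphism to the plane is orientation preserving if and only if it maps a positive
basis to two vectors that span a positive area. -/
theorem map_orientation_eq_iff (e : V ≃ₗ[ℝ] Plane) (b : Module.Basis (Fin 2) ℝ V) :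
    Orientation.map (Fin 2) e b.orientation = stdOrientation ↔
      0 < (starRingEnd ℂ (planeToComplex (e (b 0))) * planeToComplex (e (b 1))).im := by
  rw [← Module.Basis.orientation_map, stdOrientation, eq_comm,
    Module.Basis.orientation_eq_iff_det_pos, det_map_eq_area]

theorem exists_basis_orientation_eq (e : V ≃ₗ[ℝ] Plane) (ε : Orientation ℝ V (Fin 2)) :
    ∃ b : Module.Basis (Fin 2) ℝ V, b.orientation = ε := by
  have : FiniteDimensional ℝ V := e.symm.finiteDimensional
  have h : Fintype.card (Fin 2) = Module.finrank ℝ V := by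
    rw [e.finrank_eq, finrank_euclideanSpace]
  exact ⟨ε.someBasis h, ε.someBasis_orientation h⟩

end Orientation

section Dichotomy

variable {M : Type*} [TopologicalSpace M] [ChartedSpace (EuclideanHalfSpace 2) M]

/-- The derivative of a plane-valued map at a point where it is bijective. -/
noncomputable def differentialEquiv {Φ : M → ℂ} {x : M}
    (h : Function.Bijective (differential Φ x)) : TangentSpace (𝓡∂ 2) x ≃ₗ[ℝ] Plane :=
  (LinearEquiv.ofBijective (differential Φ x : TangentSpace (𝓡∂ 2) x →ₗ[ℝ] ℂ) h).trans
    planeToComplex.symm.toLinearEquiv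

theorem planeToComplex_differentialEquiv {Φ : M → ℂ} {x : M}
    (h : Function.Bijective (differential Φ x)) (v : TangentSpace (𝓡∂ 2) x) :
    planeToComplex (differentialEquiv h v) = differential Φ x v :=
  planeToComplex.apply_symm_apply _

/-- An immersion of a connected oriented surface into the plane either preserves or reverses the
orientation everywhere. -/
theorem area_pos_or_area_neg [IsManifold (𝓡∂ 2) ∞ M] [ConnectedSpace M] (o : SurfaceOrientation M)
    {Φ : M → ℂ} (hΦ : ContMDiff (𝓡∂ 2) 𝓘(ℝ, ℂ) ∞ Φ)
    (hb : ∀ x, Function.Bijective (differential Φ x)) :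
    (∀ x v w, IsPositiveBasis (o.orient x) v w →
      0 < (starRingEnd ℂ (differential Φ x v) * differential Φ x w).im) ∨
    (∀ x v w, IsPositiveBasis (o.orient x) v w →
      (starRingEnd ℂ (differential Φ x v) * differential Φ x w).im < 0) := by
  let S : Set M := {x | Orientation.map (Fin 2) (differentialEquiv (hb x)) (o.orient x) =
    stdOrientation}
  have hS : ∀ x (b : Module.Basis (Fin 2) ℝ (TangentSpace (𝓡∂ 2) x)),
      b.orientation = o.orient x →
      (x ∈ S ↔ 0 < (starRingEnd ℂ (differential Φ x (b 0)) * differential Φ x (b 1)).im) := by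
    intro x b hbo
    have := map_orientation_eq_iff (differentialEquiv (hb x)) b
    rw [hbo, planeToComplex_differentialEquiv, planeToComplex_differentialEquiv] at this
    exact this
  have hne : ∀ x (b : Module.Basis (Fin 2) ℝ (TangentSpace (𝓡∂ 2) x)),
      (starRingEnd ℂ (differential Φ x (b 0)) * differential Φ x (b 1)).im ≠ 0 := by
    intro x b
    have := area_ne_zero (differentialEquiv (hb x)) b
    rwa [planeToComplex_differentialEquiv, planeToComplex_differentialEquiv] at this
  -- Near each point, membership in `S` is decided by the sign of a continuous function.
  have hloc : ∀ x₀, ∃ g : M → ℝ, ContinuousAt g x₀ ∧ g x₀ ≠ 0 ∧ ∀ᶠ x in 𝓝 x₀, (x ∈ S ↔ 0 < g x) := by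
    intro x₀
    obtain ⟨ε, hε⟩ := o.locallyConstant x₀
    set e := trivializationAt Plane (TangentSpace (𝓡∂ 2) : M → Type _) x₀ with he
    obtain ⟨b, hbε⟩ := exists_basis_orientation_eq (LinearEquiv.refl ℝ Plane) ε
    let s : Fin 2 → M → ℂ := fun i x => differential Φ x (e.symm x (b i))
    have hx₀ : x₀ ∈ e.baseSet := mem_baseSet_trivializationAt _ _ x₀
    have hs : ∀ i, ContinuousAt (s i) x₀ := by
      intro i
      have h1 : ContinuousOn (fun x : M =>
          (⟨x, e.symm x (b i)⟩ : TangentBundle (𝓡∂ 2) M)) e.baseSet :=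
        e.continuousOn_symm.comp (by fun_prop : Continuous fun x : M => (x, b i)).continuousOn
          fun x hx => ⟨hx, trivial⟩
      exact (continuous_differential hΦ).continuousAt.comp
        (h1.continuousAt (e.open_baseSet.mem_nhds hx₀))
    have hbasis : ∀ x (hx : x ∈ e.baseSet), ∀ i,
        (b.map (e.linearEquivAt ℝ x hx).symm) i = e.symm x (b i) := fun x hx i => by
      rw [Module.Basis.map_apply, Bundle.Trivialization.linearEquivAt_symm_apply]
    refine ⟨fun x => (starRingEnd ℂ (s 0 x) * s 1 x).im, ?_, ?_, ?_⟩
    · exact Complex.continuous_im.continuousAt.comp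
        ((Complex.continuous_conj.continuousAt.comp (hs 0)).mul (hs 1))
    · have := hne x₀ (b.map (e.linearEquivAt ℝ x₀ hx₀).symm)
      rwa [hbasis, hbasis] at this
    · filter_upwards [hε] with x ⟨hx, hxo⟩
      have h1 : (b.map (e.linearEquivAt ℝ x hx).symm).orientation = o.orient x := by
        rw [Module.Basis.orientation_map, hbε, ← hxo, ← orientation_map_trans,
          LinearEquiv.self_trans_symm, Orientation.map_refl]
        rfl
      have := hS x _ h1
      rwa [hbasis, hbasis] at this
  have hclopen : IsClopen S := by
    constructor
    · rw [← isOpen_compl_iff, isOpen_iff_mem_nhds]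
      intro x₀ hx₀
      obtain ⟨g, hg, hg0, hgS⟩ := hloc x₀
      have h1 : g x₀ < 0 := lt_of_le_of_ne
        (not_lt.mp fun h => hx₀ (hgS.self_of_nhds.mpr h)) hg0
      filter_upwards [hgS, hg.eventually_lt continuousAt_const h1] with x hx hx' hxS
      exact (hx.mp hxS).not_gt hx'
    · rw [isOpen_iff_mem_nhds]
      intro x₀ hx₀
      obtain ⟨g, hg, hg0, hgS⟩ := hloc x₀
      have h1 : 0 < g x₀ := hgS.self_of_nhds.mp hx₀
      filter_upwards [hgS, continuousAt_const.eventually_lt hg h1] with x hx hx'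
      exact hx.mpr hx'
  rcases isClopen_iff.mp hclopen with h | h
  · right
    rintro x v w ⟨b, rfl, rfl, hbo⟩
    have h1 : x ∉ S := by rw [h]; exact Set.notMem_empty x
    exact lt_of_le_of_ne (not_lt.mp fun h2 => h1 ((hS x b hbo).mpr h2)) (hne x b)
  · left
    rintro x v w ⟨b, rfl, rfl, hbo⟩
    exact (hS x b hbo).mp (by rw [h]; trivial)

theorem differential_continuousLinearMap_comp {E : Type*} [NormedAddCommGroup E]
    [NormedSpace ℝ E] (L : E →L[ℝ] ℂ) {φ : M → E} (hφ : ContMDiff (𝓡∂ 2) 𝓘(ℝ, E) ∞ φ) (x : M)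
    (v : TangentSpace (𝓡∂ 2) x) :
    differential (fun x => L (φ x)) x v = L (mfderiv (𝓡∂ 2) 𝓘(ℝ, E) φ x v) := by
  have h1 := ((hφ x).mdifferentiableAt (by simp)).hasMFDerivAt
  have h2 : HasMFDerivAt 𝓘(ℝ, E) 𝓘(ℝ, ℂ) L (φ x) L := L.hasMFDerivAt
  have h3 := (h2.comp x h1).mfderiv
  exact congrArg (fun T : Plane →L[ℝ] ℂ => T v) h3

/-- If the given embedding reverses the orientation, it is composed with complex conjugation. -/
theorem IsGenusZero.exists_isHoledDiscEmbedding [IsManifold (𝓡∂ 2) ∞ M] [ConnectedSpace M]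
    (h : IsGenusZero M) (o : SurfaceOrientation M) :
    ∃ (m : ℕ) (c : Fin m → ℂ) (r : Fin m → ℝ) (Φ : M → ℂ), IsHoledDiscEmbedding o c r Φ := by
  obtain ⟨m, c, r, hr, hsub, hdisj, φ, hφ, hinj, hbij, hrange⟩ := h
  -- Any linear isometry to `ℂ` turns `φ` into an embedding onto a disc with holes.
  have key : ∀ L : Plane ≃ₗᵢ[ℝ] ℂ, (∀ x v w, IsPositiveBasis (o.orient x) v w →
      0 < (starRingEnd ℂ (differential (fun x => L (φ x)) x v) *
        differential (fun x => L (φ x)) x w).im) →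
      IsHoledDiscEmbedding o (fun i => L (c i)) r (fun x => L (φ x)) := by
    intro L hL
    have hball : ∀ p ρ, Metric.closedBall (L p) ρ = L '' Metric.closedBall p ρ := fun p ρ =>
      (L.image_closedBall p ρ).symm
    have hball' : ∀ p ρ, Metric.ball (L p) ρ = L '' Metric.ball p ρ := fun p ρ =>
      (L.image_ball p ρ).symm
    have h0 : (0 : ℂ) = L 0 := L.map_zero.symm
    refine ⟨⟨hr, fun i => ?_, fun i j hij => ?_⟩, ?_, fun x y hxy => hinj (L.injective hxy),
      fun x => ?_, ?_, hL⟩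
    · rw [h0, hball, hball']
      exact Set.image_mono (hsub i)
    · rw [hball, hball]
      exact (Set.disjoint_image_iff L.injective).mpr (hdisj i j hij)
    · exact L.toContinuousLinearEquiv.contDiff.contMDiff.comp hφ
    · have h1 : (differential (fun x => L (φ x)) x : TangentSpace (𝓡∂ 2) x → ℂ) =
          L ∘ (mfderiv (𝓡∂ 2) 𝓘(ℝ, Plane) φ x) := by
        funext v
        exact differential_continuousLinearMap_comp
          (L.toContinuousLinearEquiv : Plane →L[ℝ] ℂ) hφ x v
      rw [h1]
      exact L.bijective.comp (hbij x)
    · have h1 : Set.range (fun x => L (φ x)) = L '' Set.range φ := Set.range_comp L φ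
      rw [h1, hrange, discWithHoles, Set.image_sdiff L.injective, Set.image_iUnion, h0, hball]
      simp only [hball']
  let L₀ : Plane ≃ₗᵢ[ℝ] ℂ := Complex.orthonormalBasisOneI.repr.symm
  have hsmooth : ContMDiff (𝓡∂ 2) 𝓘(ℝ, ℂ) ∞ fun x => L₀ (φ x) :=
    L₀.toContinuousLinearEquiv.contDiff.contMDiff.comp hφ
  have hd : ∀ (L : Plane ≃ₗᵢ[ℝ] ℂ) x (v : TangentSpace (𝓡∂ 2) x),
      differential (fun x => L (φ x)) x v = L (mfderiv (𝓡∂ 2) 𝓘(ℝ, Plane) φ x v) :=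
    fun L x v => differential_continuousLinearMap_comp
      (L.toContinuousLinearEquiv : Plane →L[ℝ] ℂ) hφ x v
  have hb : ∀ x, Function.Bijective (differential (fun x => L₀ (φ x)) x) := fun x => by
    have h1 : (differential (fun x => L₀ (φ x)) x : TangentSpace (𝓡∂ 2) x → ℂ) =
        L₀ ∘ (mfderiv (𝓡∂ 2) 𝓘(ℝ, Plane) φ x) := funext (hd L₀ x)
    rw [h1]
    exact L₀.bijective.comp (hbij x)
  rcases area_pos_or_area_neg o hsmooth hb with hpos | hneg
  · exact ⟨m, _, r, _, key L₀ hpos⟩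
  · refine ⟨m, _, r, _, key (L₀.trans Complex.conjLIE) fun x v w hvw => ?_⟩
    have h1 := hneg x v w hvw
    rw [hd] at h1 ⊢
    rw [hd] at h1 ⊢
    have h2 : ∀ z w : ℂ, (starRingEnd ℂ z * w).im < 0 →
        0 < (starRingEnd ℂ (starRingEnd ℂ z) * starRingEnd ℂ w).im := fun z w h => by
      simp at h ⊢
      linarith
    exact h2 _ _ h1

end Dichotomy

/-! ### Framings in complex coordinates -/

section Framings

variable {M : Type*} [TopologicalSpace M] [ChartedSpace (EuclideanHalfSpace 2) M]
  [IsManifold (𝓡∂ 2) ∞ M] {o : SurfaceOrientation M} {Φ : M → ℂ}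

/-- The signed area spanned by the images of two vectors under `z ↦ a z + b z̄`. -/
theorem area_linear_add_conj (a b z w : ℂ) :
    (starRingEnd ℂ (a * z + b * starRingEnd ℂ z) * (a * w + b * starRingEnd ℂ w)).im =
      (‖a‖ ^ 2 - ‖b‖ ^ 2) * (starRingEnd ℂ z * w).im := by
  rw [← Complex.normSq_eq_norm_sq, ← Complex.normSq_eq_norm_sq]
  simp [Complex.normSq_apply]
  ring

/-- In terms of an immersion `Φ` of the surface into the plane, the framing `f` is
`v ↦ a z + b z̄` with `z = dΦ(v)`. It preserves orientations if and only if `‖b‖ < ‖a‖`. -/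
structure HasCoefficients (Φ : M → ℂ) (f : Framing o) (a b : M → ℂ) : Prop where
  continuous_linear : Continuous a
  continuous_conj : Continuous b
  lt : ∀ x, ‖b x‖ < ‖a x‖
  apply : ∀ x (v : TangentSpace (𝓡∂ 2) x), planeToComplex (f.1 ⟨x, v⟩) =
    a x * differential Φ x v + b x * starRingEnd ℂ (differential Φ x v)

theorem HasCoefficients.ne_zero {f : Framing o} {a b : M → ℂ} (h : HasCoefficients Φ f a b)
    (x : M) : a x ≠ 0 :=
  norm_ne_zero_iff.mp ((norm_nonneg _).trans_lt (h.lt x)).ne'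

/-- The vector field that the immersion `Φ` maps to a constant vector field is continuous. -/
theorem exists_continuous_lift_of_const (hΦ : ContMDiff (𝓡∂ 2) 𝓘(ℝ, ℂ) ∞ Φ)
    (hb : ∀ x, Function.Bijective (differential Φ x)) (w : ℂ) :
    ∃ X : ∀ x : M, TangentSpace (𝓡∂ 2) x,
      (Continuous fun x => (⟨x, X x⟩ : TangentBundle (𝓡∂ 2) M)) ∧
      ∀ x, differential Φ x (X x) = w := by
  have : IsManifold (𝓡∂ 2) 1 M := .of_le (n := ∞) (by simp)
  have hV : ContMDiff 𝓘(ℝ, ℂ) (𝓘(ℝ, ℂ).prod 𝓘(ℝ, ℂ)) 0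
      (fun y : ℂ => (⟨y, w⟩ : TangentBundle 𝓘(ℝ, ℂ) ℂ)) :=
    contMDiff_vectorSpace_iff_contDiff.mpr contDiff_const
  have hinv : ∀ x, (mfderiv (𝓡∂ 2) 𝓘(ℝ, ℂ) Φ x).IsInvertible := fun x => by
    let L : Plane →L[ℝ] ℂ := chartDifferential Φ x
    have hL : Function.Bijective L := by
      have h1 : (L : Plane → ℂ) = differential Φ x := by
        funext v
        exact (differential_eq_chartDifferential hΦ x v).symm
      rw [h1]
      exact hb x
    have h2 : L.IsInvertible :=
      ⟨ContinuousLinearEquiv.ofBijective L (LinearMap.ker_eq_bot.mpr hL.1)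
        (LinearMap.range_eq_top.mpr hL.2), by ext v; rfl⟩
    have h3 : (mfderiv (𝓡∂ 2) 𝓘(ℝ, ℂ) Φ x : Plane →L[ℝ] ℂ) = L :=
      ContinuousLinearMap.ext fun v => differential_eq_chartDifferential hΦ x v
    rw [← h3] at h2
    exact h2
  refine ⟨VectorField.mpullback (𝓡∂ 2) 𝓘(ℝ, ℂ) Φ (fun _ => w),
    (ContMDiff.mpullback_vectorField (m := 0) (n := ∞) hV hΦ hinv (by simp)).continuous,
    fun x => ?_⟩
  obtain ⟨e, he⟩ := hinv x
  show mfderiv (𝓡∂ 2) 𝓘(ℝ, ℂ) Φ x ((mfderiv (𝓡∂ 2) 𝓘(ℝ, ℂ) Φ x).inverse w) = w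
  rw [← he, ContinuousLinearMap.inverse_equiv]
  exact e.apply_symm_apply w

theorem Framing.exists_coefficients (hΦ : ContMDiff (𝓡∂ 2) 𝓘(ℝ, ℂ) ∞ Φ)
    (hb : ∀ x, Function.Bijective (differential Φ x))
    (hor : ∀ x v w, IsPositiveBasis (o.orient x) v w →
      0 < (starRingEnd ℂ (differential Φ x v) * differential Φ x w).im)
    (f : Framing o) : ∃ a b, HasCoefficients Φ f a b := by
  obtain ⟨X, hX, hX1⟩ := exists_continuous_lift_of_const hΦ hb 1
  obtain ⟨Y, hY, hYI⟩ := exists_continuous_lift_of_const hΦ hb Complex.I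
  let p : M → ℂ := fun x => planeToComplex (f.1 ⟨x, X x⟩)
  let q : M → ℂ := fun x => planeToComplex (f.1 ⟨x, Y x⟩)
  have hp : Continuous p := planeToComplex.continuous.comp (f.1.continuous.comp hX)
  have hq : Continuous q := planeToComplex.continuous.comp (f.1.continuous.comp hY)
  have happly : ∀ x (v : TangentSpace (𝓡∂ 2) x), planeToComplex (f.1 ⟨x, v⟩) =
      ((p x - Complex.I * q x) / 2) * differential Φ x v +
        ((p x + Complex.I * q x) / 2) * starRingEnd ℂ (differential Φ x v) := by
    intro x v
    obtain ⟨e, he, -⟩ := f.2 x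
    have hv : v = (differential Φ x v).re • X x + (differential Φ x v).im • Y x := by
      apply (hb x).1
      rw [map_add, map_smul, map_smul, hX1, hYI]
      simp
    have h1 : planeToComplex (f.1 ⟨x, v⟩) =
        (differential Φ x v).re * p x + (differential Φ x v).im * q x := by
      have h2 : e v = (differential Φ x v).re • e (X x) + (differential Φ x v).im • e (Y x) := by
        conv_lhs => rw [hv]
        rw [map_add, map_smul, map_smul]
      simp only [p, q, he]
      rw [h2, map_add, map_smul, map_smul, Complex.real_smul, Complex.real_smul]
    rw [h1]
    generalize differential Φ x v = z
    apply Complex.ext <;> simp <;> ring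
  refine ⟨_, _, by fun_prop, by fun_prop, fun x => ?_, happly⟩
  obtain ⟨e, he, heo⟩ := f.2 x
  obtain ⟨b, hbo⟩ := exists_basis_orientation_eq (differentialEquiv (hb x)) (o.orient x)
  rw [← hbo, map_orientation_eq_iff, ← he, ← he, happly, happly, area_linear_add_conj] at heo
  have h1 := hor x (b 0) (b 1) ⟨b, rfl, rfl, hbo⟩
  have h2 := pos_of_mul_pos_left heo h1.le
  exact lt_of_pow_lt_pow_left₀ 2 (norm_nonneg _) (by linarith)

/-- The map `z ↦ a z + b z̄` is injective and orientation preserving if `‖b‖ < ‖a‖`. -/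
theorem isFraming_of_coefficients (hb : ∀ x, Function.Bijective (differential Φ x))
    (hor : ∀ x v w, IsPositiveBasis (o.orient x) v w →
      0 < (starRingEnd ℂ (differential Φ x v) * differential Φ x w).im)
    {f : C(TangentBundle (𝓡∂ 2) M, Plane)} {a b : M → ℂ} (hlt : ∀ x, ‖b x‖ < ‖a x‖)
    (happly : ∀ x (v : TangentSpace (𝓡∂ 2) x), planeToComplex (f ⟨x, v⟩) =
      a x * differential Φ x v + b x * starRingEnd ℂ (differential Φ x v)) : IsFraming o f := by
  intro x
  let T : ℂ →ₗ[ℝ] ℂ :=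
    { toFun := fun z => a x * z + b x * starRingEnd ℂ z
      map_add' := fun z w => by rw [map_add]; ring
      map_smul' := fun t z => by
        simp only [Complex.real_smul, map_mul, Complex.conj_ofReal, RingHom.id_apply]
        ring }
  have hT : Function.Injective T := by
    rw [← LinearMap.ker_eq_bot, LinearMap.ker_eq_bot']
    intro z hz
    have h1 : a x * z = -(b x * starRingEnd ℂ z) := eq_neg_of_add_eq_zero_left hz
    have h2 := congrArg norm h1
    rw [norm_neg, norm_mul, norm_mul, RCLike.norm_conj] at h2
    by_contra hz0
    exact (mul_lt_mul_of_pos_right (hlt x) (norm_pos_iff.mpr hz0)).ne' h2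
  let e : TangentSpace (𝓡∂ 2) x ≃ₗ[ℝ] Plane :=
    ((LinearEquiv.ofBijective (differential Φ x : TangentSpace (𝓡∂ 2) x →ₗ[ℝ] ℂ) (hb x)).trans
      (LinearEquiv.ofBijective T ⟨hT, LinearMap.injective_iff_surjective.mp hT⟩)).trans
      planeToComplex.symm.toLinearEquiv
  have he : ∀ v, planeToComplex (e v) =
      a x * differential Φ x v + b x * starRingEnd ℂ (differential Φ x v) := fun v =>
    planeToComplex.apply_symm_apply _
  refine ⟨e, fun v => planeToComplex.injective ((happly x v).trans (he v).symm), ?_⟩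
  obtain ⟨β, hβ⟩ := exists_basis_orientation_eq e (o.orient x)
  rw [← hβ, map_orientation_eq_iff, he, he, area_linear_add_conj]
  refine mul_pos ?_ (hor x _ _ ⟨β, rfl, rfl, hβ⟩)
  have := pow_lt_pow_left₀ (hlt x) (norm_nonneg _) two_ne_zero
  linarith

theorem exists_framing_of_coefficient (hΦ : ContMDiff (𝓡∂ 2) 𝓘(ℝ, ℂ) ∞ Φ)
    (hb : ∀ x, Function.Bijective (differential Φ x))
    (hor : ∀ x v w, IsPositiveBasis (o.orient x) v w →
      0 < (starRingEnd ℂ (differential Φ x v) * differential Φ x w).im)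
    {a : M → ℂ} (ha : Continuous a) (h0 : ∀ x, a x ≠ 0) :
    ∃ f : Framing o, HasCoefficients Φ f a (fun _ => 0) := by
  have hc : Continuous fun p : TangentBundle (𝓡∂ 2) M => a p.1 * differential Φ p.1 p.2 :=
    (ha.comp (FiberBundle.continuous_proj Plane (TangentSpace (𝓡∂ 2)))).mul
      (continuous_differential hΦ)
  let f : C(TangentBundle (𝓡∂ 2) M, Plane) :=
    ⟨fun p => planeToComplex.symm (a p.1 * differential Φ p.1 p.2),
      planeToComplex.symm.continuous.comp hc⟩
  have hf : ∀ x (v : TangentSpace (𝓡∂ 2) x), planeToComplex (f ⟨x, v⟩) =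
      a x * differential Φ x v + (fun _ : M => (0 : ℂ)) x * starRingEnd ℂ (differential Φ x v) :=
    fun x v => by
      simp only [zero_mul, add_zero]
      exact planeToComplex.apply_symm_apply _
  have hlt : ∀ x, ‖(fun _ : M => (0 : ℂ)) x‖ < ‖a x‖ := fun x => by
    simpa using h0 x
  exact ⟨⟨f, isFraming_of_coefficients hb hor hlt hf⟩, ha, continuous_const, hlt, hf⟩

/-- Framings are homotopic if the quotient of their complex-linear coefficients has a logarithm. -/
theorem HasCoefficients.homotopic (hΦ : ContMDiff (𝓡∂ 2) 𝓘(ℝ, ℂ) ∞ Φ)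
    (hb : ∀ x, Function.Bijective (differential Φ x))
    (hor : ∀ x v w, IsPositiveBasis (o.orient x) v w →
      0 < (starRingEnd ℂ (differential Φ x v) * differential Φ x w).im)
    {f₁ f₂ : Framing o} {a₁ b₁ a₂ b₂ : M → ℂ} (h₁ : HasCoefficients Φ f₁ a₁ b₁)
    (h₂ : HasCoefficients Φ f₂ a₂ b₂) {g : M → ℂ} (hg : Continuous g)
    (he : ∀ x, a₂ x = a₁ x * Complex.exp (g x)) : f₁.Homotopic f₂ := by
  -- The coefficients move by the factor `exp (s g)`; up to it, the first one is constant and the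
  -- second one moves on a segment in the disc of radius `‖a₁‖`.
  let A : ℝ → M → ℂ := fun s x => a₁ x * Complex.exp (s * g x)
  let C : ℝ → M → ℂ := fun s x =>
    Complex.exp (s * g x) * ((1 - s) * b₁ x + s * (b₂ x * Complex.exp (-g x)))
  have hlt : ∀ s : ℝ, 0 ≤ s → s ≤ 1 → ∀ x, ‖C s x‖ < ‖A s x‖ := by
    intro s hs0 hs1 x
    simp only [A, C]
    rw [norm_mul, norm_mul, mul_comm]
    refine mul_lt_mul_of_pos_right ?_ (norm_pos_iff.mpr (Complex.exp_ne_zero _))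
    have h3 : ‖b₂ x * Complex.exp (-g x)‖ < ‖a₁ x‖ := by
      have h4 : a₁ x = a₂ x * Complex.exp (-g x) := by
        rw [he, mul_assoc, ← Complex.exp_add, add_neg_cancel, Complex.exp_zero, mul_one]
      rw [h4, norm_mul, norm_mul]
      exact mul_lt_mul_of_pos_right (h₂.lt x) (norm_pos_iff.mpr (Complex.exp_ne_zero _))
    have hconv := convex_ball (0 : ℂ) ‖a₁ x‖ (mem_ball_zero_iff.mpr (h₁.lt x))
      (mem_ball_zero_iff.mpr h3) (sub_nonneg.mpr hs1) hs0 (by ring)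
    rw [mem_ball_zero_iff, Complex.real_smul, Complex.real_smul] at hconv
    simpa using hconv
  have hπ : Continuous fun p : TangentBundle (𝓡∂ 2) M => p.1 :=
    FiberBundle.continuous_proj Plane (TangentSpace (𝓡∂ 2))
  let d : TangentBundle (𝓡∂ 2) M → ℂ := fun p => differential Φ p.1 p.2
  have hd : Continuous d := continuous_differential hΦ
  let F : unitInterval × TangentBundle (𝓡∂ 2) M → Plane := fun q =>
    planeToComplex.symm (A q.1 q.2.1 * d q.2 + C q.1 q.2.1 * starRingEnd ℂ (d q.2))
  have hF : Continuous F := by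
    have e1 := h₁.continuous_linear.comp hπ
    have e2 := h₁.continuous_conj.comp hπ
    have e3 := h₂.continuous_conj.comp hπ
    have e4 := hg.comp hπ
    refine planeToComplex.symm.continuous.comp ?_
    have e5 : Continuous fun q : unitInterval × TangentBundle (𝓡∂ 2) M => d q.2 :=
      hd.comp continuous_snd
    have e6 : Continuous fun q : unitInterval × TangentBundle (𝓡∂ 2) M => a₁ q.2.1 :=
      e1.comp continuous_snd
    have e7 : Continuous fun q : unitInterval × TangentBundle (𝓡∂ 2) M => b₁ q.2.1 :=
      e2.comp continuous_snd
    have e8 : Continuous fun q : unitInterval × TangentBundle (𝓡∂ 2) M => b₂ q.2.1 :=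
      e3.comp continuous_snd
    have e9 : Continuous fun q : unitInterval × TangentBundle (𝓡∂ 2) M => g q.2.1 :=
      e4.comp continuous_snd
    have e10 : Continuous fun q : unitInterval × TangentBundle (𝓡∂ 2) M => ((q.1 : ℝ) : ℂ) := by
      fun_prop
    have e11 := Complex.continuous_exp.comp (e10.mul e9)
    exact ((e6.mul e11).mul e5).add ((e11.mul (((continuous_const.sub e10).mul e7).add
      (e10.mul (e8.mul (Complex.continuous_exp.comp e9.neg))))).mul
        (Complex.continuous_conj.comp e5))
  refine ⟨⟨⟨⟨F, hF⟩, ?_, ?_⟩, ?_⟩⟩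
  · rintro ⟨x, v⟩
    apply planeToComplex.injective
    have h3 := h₁.apply x v
    simpa [F, A, C, d] using h3.symm
  · rintro ⟨x, v⟩
    apply planeToComplex.injective
    have h3 := h₂.apply x v
    have h4 : Complex.exp (g x) * (b₂ x * Complex.exp (-g x)) = b₂ x := by
      rw [mul_left_comm, ← Complex.exp_add, add_neg_cancel, Complex.exp_zero, mul_one]
    rw [he] at h3
    simpa [F, A, C, d, h4] using h3.symm
  · intro s
    exact isFraming_of_coefficients hb hor (hlt s s.2.1 s.2.2)
      fun x v => planeToComplex.apply_symm_apply _

/-! ### Rotation numbers in complex coordinates -/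

theorem turnsAround_of_winds {c : ℝ → Plane} {k : ℤ}
    (h : Winds (fun t => planeToComplex (c t)) k) : TurnsAround c k := by
  obtain ⟨L, hL, he, hp⟩ := h
  replace he : ∀ t, Complex.exp (L t) = planeToComplex (c t) := he
  have hpi : (2 * Real.pi) ≠ 0 := by positivity
  refine ⟨fun t => (L t).im / (2 * Real.pi), ⟨by fun_prop, fun t => ?_⟩, fun t => ?_⟩
  · have h1 : ‖c t‖ = Real.exp (L t).re := by
      rw [← norm_planeToComplex, ← he, Complex.norm_exp]
    have h2 := he t
    rw [planeToComplex_apply] at h2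
    dsimp only
    rw [mul_div_cancel₀ _ hpi, h1, ← Complex.exp_re, ← Complex.exp_im, h2]
    exact ⟨rfl, rfl⟩
  · simp only [hp]
    simp
    field_simp

theorem Framing.velocityCurve_ne_zero (f : Framing o) (γ : ImmersedLoop M) (t : ℝ) :
    f.velocityCurve γ t ≠ 0 := by
  intro ht
  obtain ⟨e, he, -⟩ := f.2 (γ.toFun t)
  rw [Framing.velocityCurve, he] at ht
  exact γ.velocity_ne_zero t ((LinearEquiv.map_eq_zero_iff e).mp ht)

theorem Framing.rot_eq_of_winds {f : Framing o} {γ : ImmersedLoop M} {k : ℤ}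
    (h : Winds (fun t => planeToComplex (f.velocityCurve γ t)) k) : f.rot γ = k :=
  TurnsAround.unique (f.velocityCurve_ne_zero γ) (f.turnsAround_rot γ) (turnsAround_of_winds h)

theorem ImmersedLoop.mk_velocity_add_one (γ : ImmersedLoop M) (t : ℝ) :
    (⟨γ.toFun (t + 1), γ.velocity (t + 1)⟩ : TangentBundle (𝓡∂ 2) M) =
      ⟨γ.toFun t, γ.velocity t⟩ := by
  have hτ : MDifferentiable 𝓘(ℝ, ℝ) 𝓘(ℝ, ℝ) fun s : ℝ => s + 1 :=
    (differentiable_id.add_const 1).mdifferentiable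
  have hγ : MDifferentiable 𝓘(ℝ, ℝ) (𝓡∂ 2) γ.toFun := γ.smooth.mdifferentiable (by simp)
  have hcomp : γ.toFun ∘ (fun s : ℝ => s + 1) = γ.toFun := funext γ.periodic
  have h1 := tangentMap_comp_at (I := 𝓘(ℝ, ℝ)) (I' := 𝓘(ℝ, ℝ)) (I'' := 𝓡∂ 2)
    (g := γ.toFun) (f := fun s : ℝ => s + 1) ⟨t, (1 : ℝ)⟩ (hγ _) (hτ _)
  have h2 : tangentMap 𝓘(ℝ, ℝ) 𝓘(ℝ, ℝ) (fun s : ℝ => s + 1) ⟨t, (1 : ℝ)⟩ =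
      ⟨t + 1, (1 : ℝ)⟩ := by
    simp [tangentMap, mfderiv_eq_fderiv]
    rfl
  rw [hcomp, h2] at h1
  exact h1.symm

theorem Framing.winds_rot (f : Framing o) (γ : ImmersedLoop M) :
    Winds (fun t => planeToComplex (f.velocityCurve γ t)) (f.rot γ) := by
  obtain ⟨k, hk⟩ := exists_winds (z := fun t => planeToComplex (f.velocityCurve γ t))
    (planeToComplex.continuous.comp (f.1.continuous.comp γ.continuous_velocity))
    (fun t => (map_ne_zero_iff _ planeToComplex.injective).mpr (f.velocityCurve_ne_zero γ t))
    (fun t => congrArg (fun p => planeToComplex (f.1 p)) (γ.mk_velocity_add_one t))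
  rw [f.rot_eq_of_winds hk]
  exact hk

/-- The rotation number of a framing with coefficients `a`, `b` along a loop `γ` is the winding
number of `a` along `γ` plus that of the velocity of the plane curve `Φ ∘ γ`. -/
theorem HasCoefficients.rot_eq {f : Framing o} {a b : M → ℂ} (h : HasCoefficients Φ f a b)
    {γ : ImmersedLoop M} {k l : ℤ} (hk : Winds (fun t => a (γ.toFun t)) k)
    (hΦ : ContMDiff (𝓡∂ 2) 𝓘(ℝ, ℂ) ∞ Φ)
    (hl : Winds (fun t => differential Φ (γ.toFun t) (γ.velocity t)) l) : f.rot γ = k + l := by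
  apply Framing.rot_eq_of_winds
  have hd : ∀ t, differential Φ (γ.toFun (t + 1)) (γ.velocity (t + 1)) =
      differential Φ (γ.toFun t) (γ.velocity t) := fun t =>
    congrArg (fun p : TangentBundle (𝓡∂ 2) M => differential Φ p.1 p.2) (γ.mk_velocity_add_one t)
  have hdc : Continuous fun t => differential Φ (γ.toFun t) (γ.velocity t) :=
    (continuous_differential hΦ).comp γ.continuous_velocity
  have hd0 := hl.ne_zero
  have h1 := (hk.mul hl).add_small
    (w := fun t => b (γ.toFun t) * starRingEnd ℂ (differential Φ (γ.toFun t) (γ.velocity t)))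
    (fun t => by rw [hd, γ.periodic])
    ((h.continuous_conj.comp γ.smooth.continuous).mul (Complex.continuous_conj.comp hdc))
    (fun t => by rw [hd, γ.periodic])
    (fun t => by
      rw [norm_mul, norm_mul, RCLike.norm_conj]
      exact mul_lt_mul_of_pos_right (h.lt _) (norm_pos_iff.mpr (hd0 t)))
  simp only [← h.apply] at h1
  exact h1

theorem Framing.Homotopic.rot_eq {f₁ f₂ : Framing o} (h : f₁.Homotopic f₂) (γ : ImmersedLoop M) :
    f₁.rot γ = f₂.rot γ := by
  obtain ⟨F⟩ := h
  let f : unitInterval → Framing o := fun s => ⟨⟨fun p => F (s, p), by fun_prop⟩, F.prop' s⟩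
  let Z : ℝ × ℝ → ℂ := fun q =>
    planeToComplex ((f (Set.projIcc 0 1 zero_le_one q.1)).velocityCurve γ q.2)
  have hZ : Continuous Z := by
    have h1 : Continuous fun q : ℝ × ℝ => (Set.projIcc (0 : ℝ) 1 zero_le_one q.1,
        (⟨γ.toFun q.2, γ.velocity q.2⟩ : TangentBundle (𝓡∂ 2) M)) :=
      (continuous_projIcc.comp continuous_fst).prodMk (γ.continuous_velocity.comp continuous_snd)
    exact planeToComplex.continuous.comp (F.continuous.comp h1)
  have hZ0 : ∀ q, Z q ≠ 0 := fun q =>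
    (map_ne_zero_iff _ planeToComplex.injective).mpr (Framing.velocityCurve_ne_zero _ γ _)
  have hZp : ∀ s t, Z (s, t + 1) = Z (s, t) := fun s t =>
    congrArg (fun p => planeToComplex ((f (Set.projIcc 0 1 zero_le_one s)).1 p))
      (γ.mk_velocity_add_one t)
  have e0 : ∀ t, Z (0, t) = planeToComplex (f₁.velocityCurve γ t) := fun t => by
    simp only [Z, Set.projIcc_left]
    exact congrArg planeToComplex (F.apply_zero _)
  have e1 : ∀ t, Z (1, t) = planeToComplex (f₂.velocityCurve γ t) := fun t => by
    simp only [Z, Set.projIcc_right]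
    exact congrArg planeToComplex (F.apply_one _)
  have h0 : Winds (fun t => Z (0, t)) (f₁.rot γ) := by
    simpa only [e0] using f₁.winds_rot γ
  have h1 := Winds.homotopy hZ hZ0 hZp 0 1 h0
  simp only [e1] at h1
  exact (Framing.rot_eq_of_winds h1).symm

/-- A diffeomorphism that fixes a loop pointwise does not change the rotation number along it. -/
theorem Framing.rot_pullback (f : Framing o) (φ : BoundaryFixingDiffeo o) (γ : ImmersedLoop M)
    (hγ : ∀ t, φ.toDiffeo (γ.toFun t) = γ.toFun t) : (f.pullback φ).rot γ = f.rot γ := by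
  have h : (f.pullback φ).velocityCurve γ = f.velocityCurve γ := by
    funext t
    have hd : MDifferentiable 𝓘(ℝ, ℝ) (𝓡∂ 2) γ.toFun := γ.smooth.mdifferentiable (by simp)
    have hφ : MDifferentiable (𝓡∂ 2) (𝓡∂ 2) φ.toDiffeo :=
      φ.toDiffeo.contMDiff.mdifferentiable (by simp)
    have h1 := tangentMap_comp_at (I := 𝓘(ℝ, ℝ)) (I' := 𝓡∂ 2) (I'' := 𝓡∂ 2)
      (g := φ.toDiffeo) (f := γ.toFun) ⟨t, (1 : ℝ)⟩ (hφ _) (hd _)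
    have hcomp : φ.toDiffeo ∘ γ.toFun = γ.toFun := funext hγ
    rw [hcomp] at h1
    exact congrArg f.1 h1.symm
  rw [Framing.rot, Framing.rot, h]

end Framings

/-! ### The classification of framings -/

namespace IsHoledDiscEmbedding

variable {M : Type*} [TopologicalSpace M] [ChartedSpace (EuclideanHalfSpace 2) M]
  [IsManifold (𝓡∂ 2) ∞ M] {o : SurfaceOrientation M} {m : ℕ} {c : Fin m → ℂ} {r : Fin m → ℝ}
  {Φ : M → ℂ} {n : ℕ} {B : BoundaryNumbering o n} {σ : Fin (n + 1) ≃ Option (Fin m)}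

theorem exists_winds_loop (γ : ImmersedLoop M) {a : M → ℂ} (ha : Continuous a)
    (h0 : ∀ x, a x ≠ 0) : ∃ k, Winds (fun t => a (γ.toFun t)) k :=
  exists_winds (ha.comp γ.smooth.continuous) (fun _ => h0 _) fun t => by rw [γ.periodic]

theorem rot_loop (h : IsHoledDiscEmbedding o c r Φ)
    (hσ : ∀ j, RunsAround Φ (circleCenter c) (circleRadius r) (circleSign m) (B.loop j) (σ j))
    {f : Framing o} {a b : M → ℂ} (hf : HasCoefficients Φ f a b) {j : Fin (n + 1)} {k : ℤ}
    (hk : Winds (fun t => a ((B.loop j).toFun t)) k) :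
    f.rot (B.loop j) = k + circleSign m (σ j) :=
  hf.rot_eq hk h.smooth (hσ j).winds_velocity

theorem sum_circleSign_add_one (σ : Fin (n + 1) ≃ Option (Fin m)) :
    ∑ j, (circleSign m (σ j) + 1) = 2 := by
  rw [Equiv.sum_comp σ (fun κ => circleSign m κ + 1), Fintype.sum_option]
  simp [circleSign]

/-- The winding numbers of the coefficient of a framing add up to zero, so the sum of the rotation
numbers is that of the signs of the boundary circles: one of them is `1`, the others are `-1`. -/
theorem sum_rot_add_one [CompactSpace M] (h : IsHoledDiscEmbedding o c r Φ)
    (hσ : ∀ j, RunsAround Φ (circleCenter c) (circleRadius r) (circleSign m) (B.loop j) (σ j))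
    (f : Framing o) : ∑ j, (f.rot (B.loop j) + 1) = 2 := by
  obtain ⟨a, b, hf⟩ := f.exists_coefficients h.smooth h.bijective h.oriented
  choose k hk using fun j => exists_winds_loop (B.loop j) hf.continuous_linear hf.ne_zero
  simp only [fun j => h.rot_loop hσ hf (hk j), add_assoc]
  rw [Finset.sum_add_distrib, h.sum_winding_eq_zero hσ hf.continuous_linear hf.ne_zero hk,
    sum_circleSign_add_one, zero_add]

/-- If the rotation numbers agree, the quotient of the coefficients of the two framings does not
wind around any hole, so it has a logarithm. -/
theorem homotopic_of_rot_eq [CompactSpace M] (h : IsHoledDiscEmbedding o c r Φ)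
    (hσ : ∀ j, RunsAround Φ (circleCenter c) (circleRadius r) (circleSign m) (B.loop j) (σ j))
    {f₁ f₂ : Framing o} (hrot : ∀ j, f₁.rot (B.loop j) = f₂.rot (B.loop j)) :
    f₁.Homotopic f₂ := by
  obtain ⟨a₁, b₁, h₁⟩ := f₁.exists_coefficients h.smooth h.bijective h.oriented
  obtain ⟨a₂, b₂, h₂⟩ := f₂.exists_coefficients h.smooth h.bijective h.oriented
  obtain ⟨g, hg, he⟩ := h.exists_log hσ (a := fun x => a₂ x * a₁ x ^ (-1 : ℤ))
    (h₂.continuous_linear.mul (h₁.continuous_linear.zpow₀ _ fun x => Or.inl (h₁.ne_zero x)))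
    (fun x => mul_ne_zero (h₂.ne_zero x) (zpow_ne_zero _ (h₁.ne_zero x))) fun i => by
      obtain ⟨k₁, hk₁⟩ := exists_winds_loop (B.loop (σ.symm (some i))) h₁.continuous_linear
        h₁.ne_zero
      obtain ⟨k₂, hk₂⟩ := exists_winds_loop (B.loop (σ.symm (some i))) h₂.continuous_linear
        h₂.ne_zero
      have h3 := hrot (σ.symm (some i))
      rw [h.rot_loop hσ h₁ hk₁, h.rot_loop hσ h₂ hk₂] at h3
      have h4 := hk₂.mul (hk₁.zpow (-1))
      rwa [show k₂ + -1 * k₁ = 0 by linarith] at h4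
  refine h₁.homotopic h.smooth h.bijective h.oriented h₂ hg fun x => ?_
  have := h₁.ne_zero x
  rw [he, zpow_neg_one]
  field_simp

theorem exists_framing_rot_eq (h : IsHoledDiscEmbedding o c r Φ)
    (hσ : ∀ j, RunsAround Φ (circleCenter c) (circleRadius r) (circleSign m) (B.loop j) (σ j))
    {ν : Fin (n + 1) → ℤ} (hν : ∑ j, ν j = 2) :
    ∃ f : Framing o, ∀ j, f.rot (B.loop j) + 1 = ν j := by
  obtain ⟨a, ha, h0, hk⟩ := h.exists_winding_eq hσ
    (k := fun j => ν j - (circleSign m (σ j) + 1))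
    (by rw [Finset.sum_sub_distrib, hν, sum_circleSign_add_one, sub_self])
  obtain ⟨f, hf⟩ := exists_framing_of_coefficient h.smooth h.bijective h.oriented ha h0
  refine ⟨f, fun j => ?_⟩
  rw [h.rot_loop hσ hf (hk j)]
  ring

end IsHoledDiscEmbedding

theorem mainTheorem11 {M : Type*} [TopologicalSpace M] [T2Space M] [CompactSpace M]
    [ConnectedSpace M] [ChartedSpace (EuclideanHalfSpace 2) M] [IsManifold (𝓡∂ 2) ∞ M]
    (o : SurfaceOrientation M) (hgenus : IsGenusZero M)
    {n : ℕ} (B : BoundaryNumbering o n) :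
    (∀ f₁ f₂ : Framing o,
      f₁.Homotopic f₂ ↔ ∀ j, f₁.rot (B.loop j) = f₂.rot (B.loop j)) ∧
    (∀ (f : Framing o) (φ : BoundaryFixingDiffeo o), (f.pullback φ).Homotopic f) ∧
    ∃ ρ : FramingClass o → {ν : Fin (n + 1) → ℤ // ∑ j, ν j = 2},
      (∀ (f : Framing o) (j : Fin (n + 1)), (ρ f.homotopyClass).1 j = f.rot (B.loop j) + 1) ∧
      Function.Bijective ρ := by
  obtain ⟨m, c, r, Φ, h⟩ := hgenus.exists_isHoledDiscEmbedding o
  obtain ⟨σ, hσ⟩ := h.isPlanarEmbedding.exists_equiv_runsAround B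
  have hiff : ∀ f₁ f₂ : Framing o,
      f₁.Homotopic f₂ ↔ ∀ j, f₁.rot (B.loop j) = f₂.rot (B.loop j) := fun f₁ f₂ =>
    ⟨fun hh j => hh.rot_eq (B.loop j), fun hrot => h.homotopic_of_rot_eq hσ hrot⟩
  refine ⟨hiff, fun f φ => (hiff _ _).mpr fun j => f.rot_pullback φ (B.loop j) fun t => ?_, ?_⟩
  · refine φ.fixes_boundary _ ?_
    rw [← B.iUnion_range]
    exact Set.mem_iUnion.mpr ⟨j, t, rfl⟩
  let ρ : FramingClass o → {ν : Fin (n + 1) → ℤ // ∑ j, ν j = 2} :=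
    Quotient.lift (fun f : Framing o =>
      (⟨fun j => f.rot (B.loop j) + 1, h.sum_rot_add_one hσ f⟩ :
        {ν : Fin (n + 1) → ℤ // ∑ j, ν j = 2}))
      (fun f₁ f₂ hh => Subtype.ext (funext fun j => congrArg (· + 1) ((hiff f₁ f₂).mp hh j)))
  refine ⟨ρ, fun f j => rfl, fun x y hxy => ?_, fun ν => ?_⟩
  · induction x using Quotient.inductionOn with | h f₁ => ?_
    induction y using Quotient.inductionOn with | h f₂ => ?_
    refine Quotient.sound ((hiff f₁ f₂).mpr fun j => ?_)
    exact add_right_cancel (congrFun (congrArg Subtype.val hxy) j)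
  · obtain ⟨f, hf⟩ := h.exists_framing_rot_eq hσ ν.2
    exact ⟨f.homotopyClass, Subtype.ext (funext hf)⟩
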